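/- An instance $I$ of \emph{constructive control by deleting voters for minimax approval voting} (CCDV-MAV) consists of a finite set $C$ of $m$ candidates, a finite multiset $V$ of votes (subsets of $C$), an integer $k$ with $1\le k\le m$, a nonempty set $J\subseteq C$ with $|J|\le k$, and an integer $\ell\ge 0$. The MAV score of a committee $w\subseteq C$ with respect to a multiset of votes is the maximum of $|w\setminus v|+|v\setminus w|$ over its votes $v$ (and $0$ if there are no votes); the winning $k$-committees are the sets $w\subseteq C$ with $|w|=k$ of smallest score. The question is whether there is a sub-multiset $V'\subseteq V$ with $|V'|\le\ell$ such that $J$ is contained in every winning $k$-committee with respect to $V\setminus V'$. Let $|I|$ be the length of the encoding of $I$ in which $J$ and the votes are written as bit strings of length $m$ and $k,\ell$ in binary; running times are numbers of steps of a deterministic multi-stack Turing machine. \textbf{Theorem.} (1) For every constant $k$, CCDV-MAV restricted to instances with committee size $k$ is solvable in polynomial time. (2) There is a single algorithm that solves CCDV-MAV for all $k$ and runs in time $m^{k}\cdot m^{k-|J|}\cdot|I|^{O(1)}$; for every constant $k$ it runs in time $O^*(m^k)$, that is, in time at most $c_k\, m^{k}\,|I|^{c_k}$ with a constant $c_k$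 depending only on $k$. (3) CCDV-MAV is fixed-parameter tractable with respect to $m$: it is solvable in time $f(m)\cdot|I|^{O(1)}$ for some computable function $f$. -/

import Mathlib

/-! ### Approval elections and minimax approval voting -/

namespace ApprovalVoting

/-- Hamming distance between two sets of candidates. -/
def hamming {C : Type} [DecidableEq C] (w v : Finset C) : ℕ :=
  (w \ v).card + (v \ w).card

/-- The minimax approval score of the committee `w` for the multiset of votes `V`: the maximum
Hamming distance between `w` and a vote. (The maximum over no votes is `0`: then all committees
have the same score.) -/
def mavScore {C : Type} [DecidableEq C] (V : Multiset (Finset C)) (w : Finset C) : ℕ :=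
  (V.map fun v => hamming w v).sup

/-- An approval-based multiwinner voting rule: it maps an election (with candidates `Fin m`) and
an integer `k` to a collection of committees, the winning `k`-committees. -/
abbrev Rule : Type :=
  ∀ m : ℕ, Multiset (Finset (Fin m)) → ℕ → Set (Finset (Fin m))

/-- Minimax approval voting: the winning `k`-committees are those with the smallest score. -/
def MAV : Rule := fun _ V k =>
  {w | w.card = k ∧ ∀ w' : Finset _, w'.card = k → mavScore V w ≤ mavScore V w'}

/-! ### Constructive control by deleting voters -/

/-- An instance of constructive control by deleting voters. The candidates are `Fin m`; the
multiset of votes is presented by a list. -/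
structure CCDVInstance where
  /-- number of candidates -/
  m : ℕ
  /-- the votes, each given by its set of approved candidates -/
  votes : List (Finset (Fin m))
  /-- committee size -/
  k : ℕ
  /-- the distinguished candidates -/
  J : Finset (Fin m)
  /-- the number of votes that may be deleted -/
  l : ℕ
  k_pos : 0 < k
  k_le : k ≤ m
  J_nonempty : J.Nonempty
  J_card : J.card ≤ k

/-- Yes-instances of constructive control by deleting voters for the rule `φ`: at most `l` votes
can be deleted so that every winning `k`-committee of the remaining election contains `J`. -/
def CCDV (φ : Rule) (I : CCDVInstance) : Prop :=
  ∃ D : Multiset (Finset (Fin I.m)), D ≤ (I.votes : Multiset (Finset (Fin I.m))) ∧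
    D.card ≤ I.l ∧ ∀ w ∈ φ I.m ((I.votes : Multiset (Finset (Fin I.m))) - D) I.k, I.J ⊆ w

namespace CCDVInstance

/-- The characteristic bit string, of length `m`, of a set of candidates. -/
def bits {m : ℕ} (v : Finset (Fin m)) : List (Option Bool) :=
  List.ofFn fun i : Fin m => some (decide (i ∈ v))

/-- A natural number in binary. -/
def binary (n : ℕ) : List (Option Bool) :=
  (Computability.encodeNat n).map some

/-- The encoding of an instance as a string over the alphabet consisting of two bits (`some b`) and
a separator (`none`): the set `J`, the integers `k` and `l` in binary, and the votes. -/
def encode (I : CCDVInstance) : List (Option Bool) :=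
  bits I.J ++ none :: (binary I.k ++ none :: (binary I.l ++
    I.votes.flatMap fun v => none :: bits v))

/-- The size of an instance: the length of its encoding. -/
def size (I : CCDVInstance) : ℕ :=
  I.encode.length

end CCDVInstance

end ApprovalVoting

/-! ### Time bounds, on Mathlib's multi-stack Turing machines -/

namespace TimeBounds

open Turing Computability

open Classical in
/-- The machine `M` decides the problem `P` and, on the encoding of each instance `a`, halts with
the right answer after at most `T a` steps. -/
def DecidesInTime {α Γ : Type} (M : TM2ComputableAux Γ Bool) (enc : α → List Γ) (P : α → Prop)
    (T : α → ℕ) : Prop :=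
  ∀ a : α, Nonempty (TM2OutputsInTime M.tm ((enc a).map M.inputAlphabet.symm)
    (some ((encodeBool (decide (P a))).map M.outputAlphabet.symm)) (T a))

open Classical in
/-- `P` is decidable in time polynomial in the length of the encoding. -/
def PolyTimeDecidable {α Γ : Type} (enc : α → List Γ) (P : α → Prop) : Prop :=
  Nonempty (TM2ComputableInPolyTime enc encodeBool fun a => decide (P a))

/-- `P` is fixed-parameter tractable with respect to the parameter `κ`: it is decidable in time
`f (κ a) * |a| ^ c` for a computable function `f` and a constant `c`. -/
def FixedParameterTractable {α Γ : Type} (enc : α → List Γ) (P : α → Prop) (κ : α → ℕ) : Prop :=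
  ∃ (M : TM2ComputableAux Γ Bool) (f : ℕ → ℕ) (c : ℕ), Computable f ∧
    DecidesInTime M enc P fun a => f (κ a) * (enc a).length ^ c

end TimeBounds

/-! Which votes to delete is determined by a committee and a distance. Suppose that deleting `D`
puts `J` into every winner; let `w` be a winner of the remaining election and `d` its score. Every
vote farther than `d` from `w` was deleted, and each `k`-committee `w'` missing part of `J` scores
more than `d`, so some vote is within `d` of `w` but farther than `d` from `w'`. Conversely, given
such `w ⊇ J` and `d`, delete exactly the votes farther than `d` from `w`: then `w` scores at most
`d`, and each `w'` missing part of `J` scores more. This is `ccdv_mav_iff`; it replaces the search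
over sets of votes by a search over `d`, `w` and `w'`.

There are `m + 1` distances, the committees `w ⊇ J` leave `k - |J|` free choices, the committees
`w'` leave `k`, and each pair is checked in polynomial time. Committees are enumerated by nested
depth-first searches with a budget for added members; `dfsTime_le` shows that budget `b` costs a
factor `m ^ b` up to polynomial factors. All three statements follow from the one bound
`controlMachine_decidesInTime`, by `m ≤ |I|` and `k ≤ m`.

Since time means steps of a concrete machine, the algorithm is written in a small structured
language. `Exec.reachesIn` and `machine_outputsInTime` transfer its cost semantics to the machine,
the lemmas `exec_*` compute final stores and times, and `answer_iff` identifies the computed bit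
with the characterization. -/

/-! ### A small imperative language for multi-stack machines -/

namespace StackMachine

open Turing StateTransition

/-- A type of configurations of stacks, with stacks indexed by `κ` over the alphabet `A`. -/
class StackStore (X : Type) (κ A : outParam Type) where
  /-- the contents of a stack -/
  get : X → κ → List A
  /-- replace the contents of a stack -/
  set : X → κ → List A → X
  get_set_self : ∀ s k l, get (set s k l) k = l
  get_set_of_ne : ∀ s k l k', k' ≠ k → get (set s k l) k' = get s k'

attribute [simp] StackStore.get_set_self

open StackStore

/-- Straight-line code, executed in one step. -/
inductive Block (κ A σ : Type) : Type
  | done : Block κ A σ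
  | push (k : κ) (f : σ → A) (b : Block κ A σ) : Block κ A σ
  | pop (k : κ) (f : σ → Option A → σ) (b : Block κ A σ) : Block κ A σ
  | load (f : σ → σ) (b : Block κ A σ) : Block κ A σ
  | branch (c : σ → Bool) (b₁ b₂ : Block κ A σ) : Block κ A σ

/-- Structured programs. The loop `loop p c` repeats `p` as long as `c` holds after it. -/
inductive Prog (κ A σ : Type) : Type
  | block (b : Block κ A σ) : Prog κ A σ
  | seq (p q : Prog κ A σ) : Prog κ A σ
  | ite (c : σ → Bool) (p q : Prog κ A σ) : Prog κ A σ
  | loop (p : Prog κ A σ) (c : σ → Bool) : Prog κ A σ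

variable {κ A σ X : Type}

/-- The effect of a block. -/
def Block.eval [StackStore X κ A] : Block κ A σ → σ × X → σ × X
  | done, s => s
  | push k f b, s => b.eval (s.1, set s.2 k (f s.1 :: get s.2 k))
  | pop k f b, s => b.eval (f s.1 (get s.2 k).head?, set s.2 k (get s.2 k).tail)
  | load f b, s => b.eval (f s.1, s.2)
  | branch c b₁ b₂, s => bif c s.1 then b₁.eval s else b₂.eval s

/-- `Exec p s n s'`: started in the state `s`, the program `p` ends in the state `s'` after at most
`n` steps. -/
inductive Exec [StackStore X κ A] : Prog κ A σ → σ × X → ℕ → σ × X → Prop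
  | block {b : Block κ A σ} {s s' : σ × X} : b.eval s = s' → Exec (.block b) s 1 s'
  | seq {p q : Prog κ A σ} {s s' s'' : σ × X} {n n' : ℕ} :
      Exec p s n s' → Exec q s' n' s'' → Exec (.seq p q) s (n + n') s''
  | ite_true {c : σ → Bool} {p q : Prog κ A σ} {s s' : σ × X} {n : ℕ} :
      c s.1 = true → Exec p s n s' → Exec (.ite c p q) s (n + 1) s'
  | ite_false {c : σ → Bool} {p q : Prog κ A σ} {s s' : σ × X} {n : ℕ} :
      c s.1 = false → Exec q s n s' → Exec (.ite c p q) s (n + 1) s'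
  | loop_done {c : σ → Bool} {p : Prog κ A σ} {s s' : σ × X} {n : ℕ} :
      Exec p s n s' → c s'.1 = false → Exec (.loop p c) s (n + 1) s'
  | loop_more {c : σ → Bool} {p : Prog κ A σ} {s s' s'' : σ × X} {n n' : ℕ} :
      Exec p s n s' → c s'.1 = true → Exec (.loop p c) s' n' s'' →
        Exec (.loop p c) s (n + 1 + n') s''
  | mono {p : Prog κ A σ} {s s' : σ × X} {n n' : ℕ} : Exec p s n s' → n ≤ n' → Exec p s n' s'

theorem Exec.cast [StackStore X κ A] {p : Prog κ A σ} {s s' t t' : σ × X} {n : ℕ}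
    (h : Exec p s n s') (hs : s = t) (hs' : s' = t') : Exec p t n t' := by
  subst hs hs'; exact h

/-! #### Compilation to `TM2` -/

/-- The alphabets: `Bool` for the output stack, `A` for the other stacks. -/
def Alph (κ A : Type) : Option κ → Type
  | none => Bool
  | some _ => A

/-- The stackFamily of the machine for a given store, with output stack `o`. -/
def stackFamily [StackStore X κ A] (o : List Bool) (s : X) : ∀ k : Option κ, List (Alph κ A k)
  | none => o
  | some k => get s k

theorem update_stackFamily_some [DecidableEq κ] [StackStore X κ A] (o : List Bool) (s : X) (k : κ)
    (l : List A) : Function.update (stackFamily o s) (some k) l = stackFamily o (set s k l) := by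
  funext k'
  by_cases h : k' = some k
  · subst h
    exact (Function.update_self ..).trans (get_set_self s k l).symm
  · refine (Function.update_of_ne h _ _).trans ?_
    cases k' with
    | none => rfl
    | some k' => exact (get_set_of_ne s k l k' fun h' => h (congrArg some h')).symm

theorem update_stackFamily_none [DecidableEq κ] [StackStore X κ A] (o o' : List Bool) (s : X) :
    Function.update (stackFamily o s) none o' = stackFamily o' s := by
  funext k'
  cases k' with
  | none => exact Function.update_self ..
  | some k' => exact Function.update_of_ne (Option.some_ne_none k') _ _

/-- The statement that executes a block and then jumps to a label. -/
def Block.stmt {Λ : Type} (exit : Λ) : Block κ A σ → TM2.Stmt (Alph κ A) Λ σ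
  | done => .goto fun _ => exit
  | push k f b => .push (some k) f (b.stmt exit)
  | pop k f b => .pop (some k) f (b.stmt exit)
  | load f b => .load f (b.stmt exit)
  | branch c b₁ b₂ => .branch c (b₁.stmt exit) (b₂.stmt exit)

/-- A block compiles to a single statement ending in a jump, so it costs one machine step however
long it is; hence the cost `1` in `Exec.block`. -/
theorem Block.stepAux_stmt [DecidableEq κ] [StackStore X κ A] {Λ : Type} (exit : Λ)
    (b : Block κ A σ) (o : List Bool) (s : σ × X) :
    TM2.stepAux (b.stmt exit) s.1 (stackFamily o s.2) =
      ⟨some exit, (b.eval s).1, stackFamily o (b.eval s).2⟩ := by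
  induction b generalizing s with
  | done => rfl
  | push k f b ih =>
    simp only [stmt, TM2.stepAux, eval]
    rw [← ih, ← update_stackFamily_some]
    rfl
  | pop k f b ih =>
    simp only [stmt, TM2.stepAux, eval]
    rw [← ih, ← update_stackFamily_some]
    rfl
  | load f b ih =>
    simp only [stmt, TM2.stepAux, eval]
    rw [← ih]
  | branch c b₁ b₂ ih₁ ih₂ =>
    simp only [stmt, TM2.stepAux, eval]
    cases c s.1
    · exact ih₂ s
    · exact ih₁ s

namespace Prog

/-- The labels of a program. -/
def Label : Prog κ A σ → Type
  | block _ => Unit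
  | seq p q => p.Label ⊕ q.Label
  | ite _ p q => Option (p.Label ⊕ q.Label)
  | loop p _ => Option p.Label

/-- There are finitely many labels. -/
@[reducible] def labelFintype : (p : Prog κ A σ) → Fintype p.Label
  | block _ => inferInstanceAs (Fintype Unit)
  | seq p q =>
    letI := p.labelFintype
    letI := q.labelFintype
    inferInstanceAs (Fintype (p.Label ⊕ q.Label))
  | ite _ p q =>
    letI := p.labelFintype
    letI := q.labelFintype
    inferInstanceAs (Fintype (Option (p.Label ⊕ q.Label)))
  | loop p _ =>
    letI := p.labelFintype
    inferInstanceAs (Fintype (Option p.Label))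

/-- The label at which a program starts. -/
def entry : (p : Prog κ A σ) → p.Label
  | block _ => ()
  | seq p _ => .inl p.entry
  | ite _ _ _ => none
  | loop p _ => some p.entry

/-- The machine code of a program, for an embedding of its labels and an exit label. -/
def code {Λ : Type} : (p : Prog κ A σ) → (p.Label → Λ) → Λ → p.Label → TM2.Stmt (Alph κ A) Λ σ
  | block b, _, exit, _ => b.stmt exit
  | seq p q, ι, exit, l =>
    match l with
    | .inl l => p.code (fun l => ι (.inl l)) (ι (.inr q.entry)) l
    | .inr l => q.code (fun l => ι (.inr l)) exit l
  | ite c p q, ι, exit, l =>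
    match l with
    | none => .branch c (.goto fun _ => ι (some (.inl p.entry)))
        (.goto fun _ => ι (some (.inr q.entry)))
    | some (.inl l) => p.code (fun l => ι (some (.inl l))) exit l
    | some (.inr l) => q.code (fun l => ι (some (.inr l))) exit l
  | loop p c, ι, exit, l =>
    match l with
    | none => .branch c (.goto fun _ => ι (some p.entry)) (.goto fun _ => exit)
    | some l => p.code (fun l => ι (some l)) (ι none) l

end Prog

/-- `c'` is reached from `c` in `n` steps. -/
def ReachesIn {C : Type} (f : C → Option C) (n : ℕ) (c c' : C) : Prop :=
  (flip bind f)^[n] (some c) = some c'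

theorem ReachesIn.trans {C : Type} {f : C → Option C} {n n' : ℕ} {c c' c'' : C}
    (h : ReachesIn f n c c') (h' : ReachesIn f n' c' c'') : ReachesIn f (n + n') c c'' := by
  unfold ReachesIn at *
  rw [add_comm, Function.iterate_add_apply, h, h']

theorem ReachesIn.single {C : Type} {f : C → Option C} {c c' : C} (h : f c = some c') :
    ReachesIn f 1 c c' := h

theorem step_of_branch [DecidableEq κ] {Λ : Type} {M : Λ → TM2.Stmt (Alph κ A) Λ σ} {l : Λ}
    {c : σ → Bool} {l₁ l₂ : Λ} (h : M l = .branch c (.goto fun _ => l₁) (.goto fun _ => l₂))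
    (v : σ) (S : ∀ k, List (Alph κ A k)) :
    TM2.step M ⟨some l, v, S⟩ = some ⟨some (bif c v then l₁ else l₂), v, S⟩ := by
  rw [TM2.step, h]
  cases hc : c v <;> simp [TM2.stepAux, hc]

/-- The hypothesis `hM` speaks only of labels in the image of `ι`, so one machine `M` serves all
subprograms: each induction step restricts `ι` to the labels of a subprogram and takes as exit the
label where control goes next. -/
theorem Exec.reachesIn [DecidableEq κ] [StackStore X κ A] {Λ : Type}
    {M : Λ → TM2.Stmt (Alph κ A) Λ σ} {p : Prog κ A σ} {s s' : σ × X} {n : ℕ}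
    (h : Exec p s n s') (ι : p.Label → Λ) (exit : Λ) (hM : ∀ l, M (ι l) = p.code ι exit l) :
    ∃ n' ≤ n, ReachesIn (TM2.step M) n' ⟨some (ι p.entry), s.1, stackFamily [] s.2⟩
      ⟨some exit, s'.1, stackFamily [] s'.2⟩ := by
  induction h generalizing exit with
  | @block b s s' h =>
    refine ⟨1, le_rfl, .single ?_⟩
    rw [TM2.step, hM, ← h]
    exact congrArg some (b.stepAux_stmt exit [] s)
  | @seq p q s s' s'' n n' _ _ ih₁ ih₂ =>
    obtain ⟨n₁, hn₁, h₁⟩ := ih₁ (fun l => ι (.inl l)) (ι (.inr q.entry)) fun l => hM (.inl l)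
    obtain ⟨n₂, hn₂, h₂⟩ := ih₂ (fun l => ι (.inr l)) exit fun l => hM (.inr l)
    exact ⟨_, add_le_add hn₁ hn₂, h₁.trans h₂⟩
  | @ite_true c p q s s' n hc _ ih =>
    obtain ⟨n₁, hn₁, h₁⟩ := ih (fun l => ι (some (.inl l))) exit fun l => hM (some (.inl l))
    refine ⟨1 + n₁, by omega, ReachesIn.trans (.single ?_) h₁⟩
    refine (step_of_branch (hM none) _ _).trans ?_
    rw [hc]
    rfl
  | @ite_false c p q s s' n hc _ ih =>
    obtain ⟨n₁, hn₁, h₁⟩ := ih (fun l => ι (some (.inr l))) exit fun l => hM (some (.inr l))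
    refine ⟨1 + n₁, by omega, ReachesIn.trans (.single ?_) h₁⟩
    refine (step_of_branch (hM none) _ _).trans ?_
    rw [hc]
    rfl
  | @loop_done c p s s' n _ hc ih =>
    obtain ⟨n₁, hn₁, h₁⟩ := ih (fun l => ι (some l)) (ι none) fun l => hM (some l)
    refine ⟨n₁ + 1, by omega, h₁.trans (.single ?_)⟩
    refine (step_of_branch (hM none) _ _).trans ?_
    rw [hc]
    rfl
  | @loop_more c p s s' s'' n n' _ hc _ ih₁ ih₂ =>
    obtain ⟨n₁, hn₁, h₁⟩ := ih₁ (fun l => ι (some l)) (ι none) fun l => hM (some l)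
    obtain ⟨n₂, hn₂, h₂⟩ := ih₂ ι exit hM
    refine ⟨n₁ + 1 + n₂, by omega, (h₁.trans (.single ?_)).trans h₂⟩
    refine (step_of_branch (hM none) _ _).trans ?_
    rw [hc]
    rfl
  | mono _ hn ih =>
    obtain ⟨n₁, hn₁, h₁⟩ := ih ι exit hM
    exact ⟨n₁, hn₁.trans hn, h₁⟩

/-- The machine that runs a program with input stack `k₀` and outputs a bit computed from the final
state. -/
def machine [DecidableEq κ] [Fintype κ] [Fintype A] [Fintype σ] (p : Prog κ A σ) (k₀ : κ) (v₀ : σ)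
    (out : σ → Bool) : FinTM2 :=
  letI := p.labelFintype
  { K := Option κ
    k₀ := some k₀
    k₁ := none
    Γ := Alph κ A
    Λ := Option p.Label
    main := some p.entry
    σ := σ
    initialState := v₀
    Γk₀Fin := inferInstanceAs (Fintype A)
    m := fun l =>
      match l with
      | none => .push none out (.load (fun _ => v₀) .halt)
      | some l => p.code some none l }

/-- The additional step pushes the answer, resets the memory and halts. The configuration `haltList`
has the initial memory and only the output stack nonempty, hence the reset to `v₀` and the
hypothesis `hs'`. -/
theorem machine_outputsInTime [DecidableEq κ] [Fintype κ] [Fintype A] [Fintype σ]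
    [StackStore X κ A] {p : Prog κ A σ} {k₀ : κ} {v₀ : σ} {out : σ → Bool} {s : X} {s' : σ × X}
    {n : ℕ} (h : Exec p (v₀, s) n s') (hs : ∀ k, k ≠ k₀ → get s k = [])
    (hs' : ∀ k, get s'.2 k = []) :
    Nonempty (TM2OutputsInTime (machine p k₀ v₀ out) (get s k₀) (some [out s'.1]) (n + 1)) := by
  obtain ⟨n', hn', hr⟩ := h.reachesIn (M := (machine p k₀ v₀ out).m) some none fun _ => rfl
  have hinit : initList (machine p k₀ v₀ out) (get s k₀) =
      ⟨some (some p.entry), v₀, stackFamily [] s⟩ := by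
    unfold initList
    congr 1
    funext k
    by_cases hk : k = some k₀
    · subst hk
      exact dif_pos rfl
    · refine (dif_neg hk).trans ?_
      cases k with
      | none => rfl
      | some k => exact (hs k fun h => hk (congrArg some h)).symm
  have hhalt : haltList (machine p k₀ v₀ out) [out s'.1] =
      ⟨none, v₀, stackFamily [out s'.1] s'.2⟩ := by
    unfold haltList
    congr 1
    funext k
    cases k with
    | none => exact dif_pos rfl
    | some k =>
      refine (dif_neg (Option.some_ne_none k)).trans ?_
      exact (hs' k).symm
  have hlast : TM2.step (machine p k₀ v₀ out).m ⟨some none, s'.1, stackFamily [] s'.2⟩ =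
      some ⟨none, v₀, stackFamily [out s'.1] s'.2⟩ := by
    have := update_stackFamily_none (κ := κ) (A := A) [] [out s'.1] s'.2
    rw [← this]
    rfl
  refine ⟨⟨⟨n' + 1, ?_⟩, Nat.succ_le_succ hn'⟩⟩
  rw [hinit, Option.map_some, hhalt]
  exact hr.trans (.single hlast)

end StackMachine

/-! ### The machine for control by deleting voters -/

namespace ControlMachine

open StackMachine StackStore

/-- The alphabet of the working stacks. -/
abbrev Sym : Type := Option Bool

/-- The names of the working stacks. -/
inductive Stk : Type
  | inp | p1 | r1 | b1 | p2 | r2 | b2 | vr | l | lr | d1 | d1r | d2 | d2r | num | tmp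
  deriving DecidableEq

instance : Fintype Stk where
  elems := {.inp, .p1, .r1, .b1, .p2, .r2, .b2, .vr, .l, .lr, .d1, .d1r, .d2, .d2r, .num, .tmp}
  complete k := by cases k <;> decide

/-- The finite memory of the machine. -/
structure Vars : Type where
  /-- the last symbol read -/
  reg : Option Sym
  /-- a symbol of the outer committee -/
  x : Option Sym
  /-- a symbol of the inner committee -/
  y : Option Sym
  /-- a symbol of a vote -/
  z : Option Sym
  /-- the direction of a depth-first search (`none`: finished) -/
  mode : Option Bool
  /-- a suitable outer committee was found -/
  found : Bool
  /-- the current outer committee was refuted -/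
  bad : Bool
  /-- the inner committee does not contain all the distinguished candidates -/
  nj : Bool
  /-- too many votes have to be deleted -/
  excess : Bool
  /-- a remaining vote is far from the inner committee -/
  good : Bool
  /-- the current vote is far from the outer committee -/
  far1 : Bool
  /-- the current vote is far from the inner committee -/
  far2 : Bool
  /-- the binary number was not zero -/
  nz : Bool

noncomputable instance : Fintype Vars :=
  Fintype.ofInjective (fun v => ((v.reg, v.x, v.y, v.z), (v.mode, v.found, v.bad, v.nj),
    (v.excess, v.good), (v.far1, v.far2, v.nz))) fun v w h => by
      cases v; cases w; simp only [Prod.mk.injEq] at h; simp [h]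

/-- The contents of the working stacks. -/
@[ext]
structure Store : Type where
  /-- the input, and later the votes -/
  inp : List Sym
  /-- the decided part of the outer committee -/
  p1 : List Sym
  /-- the undecided part of the outer committee -/
  r1 : List Sym
  /-- the number of candidates that may still be added to the outer committee -/
  b1 : List Sym
  /-- the decided part of the inner committee -/
  p2 : List Sym
  /-- the undecided part of the inner committee -/
  r2 : List Sym
  /-- the number of candidates that may still be added to the inner committee -/
  b2 : List Sym
  /-- the votes already read -/
  vr : List Sym
  /-- the number of votes that may still be deleted -/
  l : List Sym
  /-- the number of deleted votes -/
  lr : List Sym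
  /-- the number of differences still allowed between a vote and the outer committee -/
  d1 : List Sym
  /-- the number of differences found -/
  d1r : List Sym
  /-- the number of differences still allowed between a vote and the inner committee -/
  d2 : List Sym
  /-- the number of differences found -/
  d2r : List Sym
  /-- a binary number -/
  num : List Sym
  /-- auxiliary stack -/
  tmp : List Sym

/-- The contents of a stack. -/
def Store.stack (s : Store) : Stk → List Sym
  | .inp => s.inp | .p1 => s.p1 | .r1 => s.r1 | .b1 => s.b1 | .p2 => s.p2 | .r2 => s.r2
  | .b2 => s.b2 | .vr => s.vr | .l => s.l | .lr => s.lr | .d1 => s.d1 | .d1r => s.d1r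
  | .d2 => s.d2 | .d2r => s.d2r | .num => s.num | .tmp => s.tmp

/-- Replace the contents of a stack. -/
def Store.replace (s : Store) (k : Stk) (l : List Sym) : Store :=
  match k with
  | .inp => { s with inp := l } | .p1 => { s with p1 := l } | .r1 => { s with r1 := l }
  | .b1 => { s with b1 := l } | .p2 => { s with p2 := l } | .r2 => { s with r2 := l }
  | .b2 => { s with b2 := l } | .vr => { s with vr := l } | .l => { s with l := l }
  | .lr => { s with lr := l } | .d1 => { s with d1 := l } | .d1r => { s with d1r := l }
  | .d2 => { s with d2 := l } | .d2r => { s with d2r := l } | .num => { s with num := l }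
  | .tmp => { s with tmp := l }

instance : StackStore Store Stk Sym where
  get := Store.stack
  set := Store.replace
  get_set_self s k l := by cases k <;> rfl
  get_set_of_ne s k l k' h := by cases k <;> cases k' <;> first | rfl | exact absurd rfl h

theorem Store.ext_get {s s' : Store} (h : ∀ k, get s k = get s' k) : s = s' :=
  Store.ext (h .inp) (h .p1) (h .r1) (h .b1) (h .p2) (h .r2) (h .b2) (h .vr) (h .l) (h .lr) (h .d1)
    (h .d1r) (h .d2) (h .d2r) (h .num) (h .tmp)

theorem get_set (s : Store) (k : Stk) (l : List Sym) (k' : Stk) :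
    get (set s k l) k' = if k' = k then l else get s k' := by
  split_ifs with h
  · rw [h, get_set_self]
  · exact get_set_of_ne s k l k' h

/-- Programs of the machine. -/
abbrev Program : Type := Prog Stk Sym Vars

/-- Straight-line code of the machine. -/
abbrev Code : Type := Block Stk Sym Vars

/-- A stack of `n` marks. -/
abbrev ticks (n : ℕ) : List Sym := List.replicate n none

namespace Vars

/-- Store the symbol read. -/
def setReg (v : Vars) (o : Option Sym) : Vars := { v with reg := o }
/-- Store a symbol of the outer committee. -/
def setX (v : Vars) (o : Option Sym) : Vars := { v with x := o }
/-- Store a symbol of the inner committee. -/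
def setY (v : Vars) (o : Option Sym) : Vars := { v with y := o }
/-- Store a symbol of a vote. -/
def setZ (v : Vars) (o : Option Sym) : Vars := { v with z := o }
/-- A symbol was read. -/
def regSome (v : Vars) : Bool := v.reg.isSome
/-- A symbol of the outer committee was read. -/
def xSome (v : Vars) : Bool := v.x.isSome
/-- The symbol read. -/
def getReg (v : Vars) : Sym := v.reg.getD none
/-- The symbol read from the outer committee. -/
def getX (v : Vars) : Sym := v.x.getD none
/-- The symbol read from the inner committee. -/
def getY (v : Vars) : Sym := v.y.getD none
/-- The symbol read from the vote. -/
def getZ (v : Vars) : Sym := v.z.getD none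
/-- Forget the symbol read. -/
def clearReg (v : Vars) : Vars := { v with reg := none }

end Vars

open Vars

/-! ### Moving and emptying stacks -/

/-- Move the contents of a stack to another one, in reverse order. -/
def move (a b : Stk) : Program :=
  .loop (.block (.pop a setReg (.branch regSome (.push b getReg .done) .done))) regSome

/-- A round takes two steps, the block and the loop test, and one round beyond the last symbol is
needed to find the stack empty. That round leaves `none` in `reg`. -/
theorem exec_move {a b : Stk} (hab : a ≠ b) (v : Vars) (s : Store) :
    Exec (move a b) (v, s) (2 * (get s a).length + 2)
      ({ v with reg := none }, set (set s a []) b ((get s a).reverse ++ get s b)) := by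
  obtain ⟨l, hl⟩ : ∃ l, get s a = l := ⟨_, rfl⟩
  induction l generalizing v s with
  | nil =>
    rw [hl]
    refine .loop_done (.block (s' := ({ v with reg := none }, _)) ?_) rfl
    simp only [Block.eval, hl, setReg, regSome, List.head?_nil, List.tail_nil, Option.isSome_none,
      cond_false, List.reverse_nil, List.nil_append, Prod.mk.injEq, true_and]
    refine Store.ext_get fun k => ?_
    simp only [get_set]
    split_ifs with h <;> simp_all
  | cons x l ih =>
    have h1 : (Block.pop a setReg (.branch regSome (.push b getReg .done) .done)).eval (v, s) =
        ({ v with reg := some x }, set (set s a l) b (x :: get s b)) := by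
      simp [Block.eval, hl, setReg, regSome, getReg, get_set, hab.symm]
    have h2 := ih { v with reg := some x } (set (set s a l) b (x :: get s b)) (by simp [get_set, hab])
    refine ((Exec.loop_more (.block h1) rfl h2).cast rfl ?_).mono ?_
    · simp only [Prod.mk.injEq, true_and]
      refine Store.ext_get fun k => ?_
      simp only [get_set, hab, hl]
      split_ifs with h <;> simp_all
    · simp only [get_set, hab, hl, if_false, if_true, List.length_cons]
      omega

/-- Empty a stack. -/
def clear (a : Stk) : Program := .loop (.block (.pop a setReg .done)) regSome

theorem exec_clear (a : Stk) (v : Vars) (s : Store) :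
    Exec (clear a) (v, s) (2 * (get s a).length + 2) ({ v with reg := none }, set s a []) := by
  obtain ⟨l, hl⟩ : ∃ l, get s a = l := ⟨_, rfl⟩
  induction l generalizing v s with
  | nil =>
    rw [hl]
    refine .loop_done (.block (s' := ({ v with reg := none }, _)) ?_) rfl
    simp [Block.eval, hl, setReg]
  | cons x l ih =>
    have h1 : (Block.pop a setReg .done).eval (v, s) = ({ v with reg := some x }, set s a l) := by
      simp [Block.eval, hl, setReg]
    have h2 := ih { v with reg := some x } (set s a l) (by simp)
    refine ((Exec.loop_more (.block h1) rfl h2).cast rfl ?_).mono ?_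
    · simp only [Prod.mk.injEq, true_and]
      refine Store.ext_get fun k => ?_
      simp only [get_set]
      split_ifs <;> rfl
    · simp only [get_set_self, hl, List.length_cons]
      omega

/-! #### Depth-first search through the committees -/

/-- One step of a depth-first search through the completions of the template on the stack `R`: the symbol `none`
is kept, other symbols become `some false` or `some true`, where each `some true` costs a mark of
the stack `B`. The program `leaf` is run for each completion, which is on the stack `P` then. -/
def dfsBody (P R B : Stk) (leaf : Program) : Program :=
  .ite (fun v => v.mode == some true)
    (.seq (.block (.pop R setReg (.branch regSome (.push P getReg .done) .done)))
      (.ite regSome (.block (.load clearReg .done))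
        (.seq leaf (.block (.load (fun v => { v with mode := some false }) .done)))))
    (.block (.pop P setReg
      (.branch (fun v => v.reg == none) (.load (fun v => { v with mode := none }) .done)
      (.branch (fun v => v.reg == some none) (.push R (fun _ => none) (.load clearReg .done))
      (.branch (fun v => v.reg == some (some true))
        (.push B (fun _ => none) (.push R (fun _ => some false) (.load clearReg .done)))
        (.pop B setReg
          (.branch regSome
            (.push P (fun _ => some true)
              (.load (fun v => { v with reg := none, mode := some true }) .done))
            (.push R (fun _ => some false) .done))))))))

/-- Depth-first search through the completions of a template. -/
def dfs (P R B : Stk) (leaf : Program) : Program :=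
  .seq (.block (.load (fun v => { v with reg := none, mode := some true }) .done))
    (.loop (dfsBody P R B leaf) (fun v => v.mode.isSome))

/-- Some completion `q` of the template, with remaining budget `b`, satisfies `test q b`. -/
def dfsAny (test : List Sym → ℕ → Bool) : List Sym → List Sym → ℕ → Bool
  | p, [], b => test p b
  | p, none :: r, b => dfsAny test (none :: p) r b
  | p, some _ :: r, b => dfsAny test (some false :: p) r b ||
      match b with
      | 0 => false
      | b + 1 => dfsAny test (some true :: p) r b

/-- The running time of a depth-first search in which the leaves take time `T`. -/
def dfsTime (T : ℕ) : List Sym → ℕ → ℕ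
  | [], _ => T + 10
  | none :: r, b => dfsTime T r b + 10
  | some _ :: r, b => dfsTime T r b + 20 +
      match b with
      | 0 => 0
      | b + 1 => dfsTime T r b

/-- Each position adds `2` to the factor `2 * r.length + 1`. The branch that spends a mark costs `m
^ b` times a factor linear in the number of remaining positions, which is less than `m`; the
increase by `2 * m ^ (b + 1)` absorbs it. The `20` in `T + 20` pays for the moves between nodes. -/
theorem dfsTime_le {T m : ℕ} (hm : 0 < m) (r : List Sym) (b : ℕ) (hr : r.length ≤ m) :
    dfsTime T r b ≤ (T + 20) * (2 * r.length + 1) * m ^ b := by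
  induction r generalizing b with
  | nil =>
    have : 1 ≤ m ^ b := Nat.one_le_pow _ _ hm
    simp only [dfsTime, List.length_nil]
    nlinarith
  | cons a r ih =>
    rw [List.length_cons] at hr ⊢
    have h1 := ih b (by omega)
    have hb : 1 ≤ m ^ b := Nat.one_le_pow _ _ hm
    cases a with
    | none =>
      simp only [dfsTime]
      nlinarith
    | some a =>
      cases b with
      | zero =>
        simp only [dfsTime]
        nlinarith
      | succ b =>
        have h2 := ih b (by omega)
        have hb' : 1 ≤ m ^ b := Nat.one_le_pow _ _ hm
        simp only [dfsTime]
        have h3 : (T + 20) * (2 * r.length + 1) * m ^ b + (T + 20) ≤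
            (T + 20) * 2 * m ^ (b + 1) :=
          calc (T + 20) * (2 * r.length + 1) * m ^ b + (T + 20)
              ≤ (T + 20) * (2 * r.length + 1) * m ^ b + (T + 20) * m ^ b :=
                Nat.add_le_add_left (Nat.le_mul_of_pos_right _ hb') _
            _ = (T + 20) * 2 * m ^ b * (r.length + 1) := by ring
            _ ≤ (T + 20) * 2 * m ^ b * m := Nat.mul_le_mul_left _ hr
            _ = (T + 20) * 2 * m ^ (b + 1) := by ring
        calc _ ≤ (T + 20) * (2 * r.length + 1) * m ^ (b + 1) +
              ((T + 20) * (2 * r.length + 1) * m ^ b + (T + 20)) := by omega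
          _ ≤ (T + 20) * (2 * r.length + 1) * m ^ (b + 1) + (T + 20) * 2 * m ^ (b + 1) :=
              Nat.add_le_add_left h3 _
          _ = _ := by ring

/-- The search is one flat loop, so visiting a subtree is not a run of a subprogram. The statement
is therefore in continuation form: `h` is a run of the loop from the moment the search climbs back
to the node (`mode = some false`), and the conclusion prefixes it with the visit of the subtree. The
function `st` hides all other stacks, and the argument of `v` is the answer accumulated so far, the
only thing that a leaf may change. -/
theorem exec_dfs_aux {P R B : Stk} {leaf : Program} (st : List Sym → List Sym → ℕ → Store)
    (hP : ∀ p r b, get (st p r b) P = p) (hR : ∀ p r b, get (st p r b) R = r)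
    (hB : ∀ p r b, get (st p r b) B = ticks b)
    (sP : ∀ p r b p', set (st p r b) P p' = st p' r b)
    (sR : ∀ p r b r', set (st p r b) R r' = st p r' b)
    (sB : ∀ p r b b', set (st p r b) B (ticks b') = st p r b')
    (v : Bool → Vars) (test : List Sym → ℕ → Bool) (T m : ℕ)
    (hleaf : ∀ q b a, q.length = m →
      Exec leaf ({ v a with reg := none, mode := some true }, st q [] b) T
        ({ v (a || test q b) with reg := none, mode := some true }, st q [] b))
    (r : List Sym) (hr : ∀ a ∈ r, a = none ∨ a = some false) (p : List Sym)
    (hm : p.length + r.length = m) (b : ℕ) (a : Bool) (n : ℕ) (s : Vars × Store)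
    (h : Exec (.loop (dfsBody P R B leaf) fun v => v.mode.isSome)
      ({ v (a || dfsAny test p r b) with reg := none, mode := some false }, st p r b) n s) :
    Exec (.loop (dfsBody P R B leaf) fun v => v.mode.isSome)
      ({ v a with reg := none, mode := some true }, st p r b) (dfsTime T r b + n) s := by
  have sB' : ∀ p r b, set (st p r b) B (none :: ticks b) = st p r (b + 1) := fun p r b =>
    sB p r b (b + 1)
  induction r generalizing p b a n s with
  | nil =>
    have hdown : Exec (dfsBody P R B leaf) ({ v a with reg := none, mode := some true }, st p [] b)
        (T + 4) ({ v (a || test p b) with reg := none, mode := some false }, st p [] b) :=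
      .mono (.ite_true rfl (.seq
        (.block (s' := ({ v a with reg := none, mode := some true }, st p [] b))
          (by simp [Block.eval, hR, sR, setReg, regSome]))
        (.ite_false rfl (.seq (hleaf p b a (by simpa using hm)) (.block rfl))))) (by omega)
    exact (hdown.loop_more rfl h).mono (by simp only [dfsTime]; omega)
  | cons x r ih =>
    have hr' : ∀ a ∈ r, a = none ∨ a = some false := fun a ha => hr a (List.mem_cons_of_mem _ ha)
    have hdown : Exec (dfsBody P R B leaf)
        ({ v a with reg := none, mode := some true }, st p (x :: r) b) 4
        ({ v a with reg := none, mode := some true }, st (x :: p) r b) :=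
      .mono (.ite_true rfl (.seq
        (.block (s' := ({ v a with reg := some x, mode := some true }, st (x :: p) r b))
          (by simp [Block.eval, hR, sR, hP, sP, setReg, regSome, getReg]))
        (.ite_true rfl (.block rfl)))) (by omega)
    have hlen : ∀ y : Sym, (y :: p).length + r.length = m := fun y => by
      simp only [List.length_cons] at hm ⊢
      omega
    rcases hr x List.mem_cons_self with rfl | rfl
    · have hup : Exec (dfsBody P R B leaf)
          ({ v (a || dfsAny test (none :: p) r b) with reg := none, mode := some false },
            st (none :: p) r b) 2
          ({ v (a || dfsAny test (none :: p) r b) with reg := none, mode := some false },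
            st p (none :: r) b) :=
        .ite_false rfl (.block (by simp [Block.eval, hR, sR, hP, sP, setReg, clearReg]))
      exact (hdown.loop_more rfl (ih hr' _ (hlen _) b a _ _ (hup.loop_more rfl h))).mono
        (by simp only [dfsTime]; omega)
    · cases b with
      | zero =>
        -- With the budget exhausted, popping `B` yields `none`, and the position is restored
        -- without trying `some true`.
        have hup : Exec (dfsBody P R B leaf)
            ({ v (a || dfsAny test (some false :: p) r 0) with reg := none, mode := some false },
              st (some false :: p) r 0) 2
            ({ v (a || dfsAny test (some false :: p) r 0) with reg := none, mode := some false },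
              st p (some false :: r) 0) :=
          .ite_false rfl (.block (by
            have := sB p r 0 0
            simp_all [Block.eval, setReg, regSome]))
        simp only [dfsAny, Bool.or_false] at h
        exact (hdown.loop_more rfl (ih hr' _ (hlen _) 0 a _ _ (hup.loop_more rfl h))).mono
          (by simp only [dfsTime]; omega)
      | succ b =>
        -- Climbing back to `some false` with a mark left spends it and turns the search downwards
        -- with `some true`; climbing back to `some true`, in `hup'`, refunds the mark.
        have hup : ∀ a', Exec (dfsBody P R B leaf)
            ({ v a' with reg := none, mode := some false }, st (some false :: p) r (b + 1)) 2
            ({ v a' with reg := none, mode := some true }, st (some true :: p) r b) := fun a' =>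
          .ite_false rfl (.block (by
            simp [Block.eval, hR, sR, hP, sP, hB, sB, setReg, regSome, List.replicate_succ]))
        have hup' : ∀ a', Exec (dfsBody P R B leaf)
            ({ v a' with reg := none, mode := some false }, st (some true :: p) r b) 2
            ({ v a' with reg := none, mode := some false }, st p (some false :: r) (b + 1)) :=
          fun a' => .ite_false rfl (.block (by
            simp [Block.eval, hR, sR, hP, sP, hB, sB', setReg, clearReg]))
        simp only [dfsAny, ← Bool.or_assoc] at h
        exact (hdown.loop_more rfl (ih hr' _ (hlen _) (b + 1) a _ _ ((hup _).loop_more rfl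
          (ih hr' _ (hlen _) b _ _ _ ((hup' _).loop_more rfl h))))).mono
          (by simp only [dfsTime]; omega)

/-- At the root `P` is empty, and popping it sets `mode` to `none`, which ends the loop. In `hw` the
components `reg` and `mode` of the initial memory are free, as the first block overwrites them. -/
theorem exec_dfs {P R B : Stk} {leaf : Program} (st : List Sym → List Sym → ℕ → Store)
    (hP : ∀ p r b, get (st p r b) P = p) (hR : ∀ p r b, get (st p r b) R = r)
    (hB : ∀ p r b, get (st p r b) B = ticks b)
    (sP : ∀ p r b p', set (st p r b) P p' = st p' r b)
    (sR : ∀ p r b r', set (st p r b) R r' = st p r' b)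
    (sB : ∀ p r b b', set (st p r b) B (ticks b') = st p r b')
    (v : Bool → Vars) (test : List Sym → ℕ → Bool) (T m : ℕ)
    (hleaf : ∀ q b a, q.length = m →
      Exec leaf ({ v a with reg := none, mode := some true }, st q [] b) T
        ({ v (a || test q b) with reg := none, mode := some true }, st q [] b))
    (r : List Sym) (hr : ∀ a ∈ r, a = none ∨ a = some false) (hm : r.length = m) (b : ℕ) (a : Bool)
    (w : Vars) (hw : { w with reg := none, mode := some true } =
      { v a with reg := none, mode := some true }) :
    Exec (dfs P R B leaf) (w, st [] r b) (dfsTime T r b + 10)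
      ({ v (a || dfsAny test [] r b) with reg := none, mode := none }, st [] r b) := by
  have hup : Exec (dfsBody P R B leaf)
      ({ v (a || dfsAny test [] r b) with reg := none, mode := some false }, st [] r b) 2
      ({ v (a || dfsAny test [] r b) with reg := none, mode := none }, st [] r b) :=
    .ite_false rfl (.block (by simp [Block.eval, hP, sP, setReg]))
  have h := exec_dfs_aux st hP hR hB sP sR sB v test T m hleaf r hr [] (by simpa using hm) b a _ _
    (.loop_done hup rfl)
  refine (Exec.seq (.block ?_) h).mono (by omega)
  exact congrArg (fun w => (w, st [] r b)) hw

/-! #### Comparing committees and votes -/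

/-- Two symbols, read as bits, differ, where `none` counts as `true`. -/
def mism (a b : Sym) : Bool := (a != some false) != (b != some false)

/-- The number of differences between two lists. -/
def dist : List Sym → List Sym → ℕ
  | a :: as, b :: bs => (mism a b).toNat + dist as bs
  | _, _ => 0

/-- Some distinguished candidate (marked `none` in the first list) is missing in the second one. -/
def missing : List Sym → List Sym → Bool
  | a :: as, b :: bs => (a == none && b == some false) || missing as bs
  | _, _ => false

/-- Rewind both committees, and look for a distinguished candidate missing in the inner one. -/
def rewind : Program :=
  .loop (.block (.pop .p1 setX (.branch xSome
    (.pop .p2 setY (.push .r1 getX (.push .r2 getY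
      (.load (fun v => { v with nj := v.nj || (v.getX == none && v.getY == some false) }) .done))))
    (.load (fun v => { v with y := none }) .done)))) xSome

theorem exec_rewind (q₁ q₂ : List Sym) (h : q₁.length = q₂.length) (v : Vars) (s : Store) :
    Exec rewind (v, { s with p1 := q₁, p2 := q₂ }) (2 * q₁.length + 2)
      ({ v with x := none, y := none, nj := v.nj || missing q₁ q₂ },
        { s with p1 := [], p2 := [], r1 := q₁.reverse ++ s.r1, r2 := q₂.reverse ++ s.r2 }) := by
  induction q₁ generalizing q₂ v s with
  | nil =>
    obtain rfl : q₂ = [] := List.length_eq_zero_iff.1 h.symm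
    exact .loop_done (.block (by simp only [missing, Bool.or_false]; rfl)) rfl
  | cons a q₁ ih =>
    obtain ⟨b, q₂, rfl⟩ : ∃ b q, q₂ = b :: q := List.exists_cons_of_length_eq_add_one h.symm
    have h2 := ih q₂ (by simpa using h)
      { v with x := some a, y := some b, nj := v.nj || (a == none && b == some false) }
      { s with r1 := a :: s.r1, r2 := b :: s.r2 }
    have h3 : Exec rewind (v, { s with p1 := a :: q₁, p2 := b :: q₂ }) _ _ :=
      .loop_more (.block rfl) rfl h2
    refine .mono (h3.cast rfl ?_) ?_
    · simp [missing, Bool.or_assoc]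
    · simp only [List.length_cons]
      omega

/-- The current symbols of the outer committee and of the vote differ. -/
def Vars.mismX (v : Vars) : Bool := v.xSome && mism v.getX v.getZ

/-- The current symbols of the inner committee and of the vote differ. -/
def Vars.mismY (v : Vars) : Bool := v.xSome && mism v.getY v.getZ

/-- Move a mark from `a` to `b`; execute `f` if there is none. -/
def tick (a b : Stk) (f : Vars → Vars) : Code :=
  .pop a setReg (.branch regSome (.push b (fun _ => none) (.load clearReg .done)) (.load f .done))

/-- Compare the next vote with both committees. -/
def compare : Program :=
  .loop (.seq (.block (.pop .r1 setX (.branch xSome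
      (.pop .r2 setY (.pop .inp setZ (.push .vr getZ (.push .p1 getX (.push .p2 getY .done)))))
      (.load (fun v => { v with y := none, z := none }) .done))))
    (.seq (.block (.branch mismX (tick .d1 .d1r fun v => { v with far1 := true }) .done))
      (.block (.branch mismY (tick .d2 .d2r fun v => { v with far2 := true }) .done)))) xSome

/-- Writing the effect with `toNat`, truncated subtraction and `min` covers match and mismatch at
once, so that the effects of successive positions add up to that of the whole distance. -/
theorem eval_mismX (v : Vars) (s : Store) (hv : v.reg = none) (a a' : ℕ) :
    (Block.branch mismX (tick .d1 .d1r fun v => { v with far1 := true }) .done).eval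
      (v, { s with d1 := ticks a, d1r := ticks a' }) =
      ({ v with far1 := v.far1 || decide (a < v.mismX.toNat) },
        { s with d1 := ticks (a - v.mismX.toNat), d1r := ticks (a' + min a v.mismX.toNat) }) := by
  obtain ⟨_⟩ := v
  subst hv
  rw [Block.eval]
  cases h : mismX _
  · simp [Block.eval]
  · cases a with
    | zero => simp; rfl
    | succ a => simp; rfl

theorem eval_mismY (v : Vars) (s : Store) (hv : v.reg = none) (a a' : ℕ) :
    (Block.branch mismY (tick .d2 .d2r fun v => { v with far2 := true }) .done).eval
      (v, { s with d2 := ticks a, d2r := ticks a' }) =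
      ({ v with far2 := v.far2 || decide (a < v.mismY.toNat) },
        { s with d2 := ticks (a - v.mismY.toNat), d2r := ticks (a' + min a v.mismY.toNat) }) := by
  obtain ⟨_⟩ := v
  subst hv
  rw [Block.eval]
  cases h : mismY _
  · simp [Block.eval]
  · cases a with
    | zero => simp; rfl
    | succ a => simp; rfl

theorem eval_far1 (v : Vars) (s : Store) (hv : v.reg = none) (a a' : ℕ) :
    (Block.branch far1 (tick .l .lr fun v => { v with excess := true })
      (.branch far2 (.load (fun v => { v with good := true }) .done) .done)).eval
      (v, { s with l := ticks a, lr := ticks a' }) =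
      ({ v with excess := v.excess || decide (a < v.far1.toNat),
                good := v.good || (!v.far1 && v.far2) },
        { s with l := ticks (a - v.far1.toNat), lr := ticks (a' + min a v.far1.toNat) }) := by
  obtain ⟨_, _, _, _, _, _, _, _, _, _, f₁, f₂, _⟩ := v
  subst hv
  cases f₁
  · cases f₂
    · simp [Block.eval]
    · simp [Block.eval]
  · cases a with
    | zero => simp; rfl
    | succ a => simp; rfl

/-- Together with `min_add_min_sub` this telescopes the budgets over successive positions and votes:
an overrun at either stage is an overrun of the total, and the marks used add up. -/
theorem lt_or_sub_lt (a i j : ℕ) :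
    (decide (a < i) || decide (a - i < j)) = decide (a < i + j) := by
  rw [← Bool.decide_or, decide_eq_decide]
  omega

theorem min_add_min_sub (a i j : ℕ) : min a i + min (a - i) j = min a (i + j) := by
  omega

/-- Marks are moved from `d1` to `d1r` and from `d2` to `d2r`, never destroyed, so both budgets can
be restored for the next vote even after running out. -/
theorem exec_compare (w₁ w₂ u rest : List Sym) (h₁ : w₁.length = u.length)
    (h₂ : w₂.length = u.length) (v : Vars) (hv : v.reg = none) (s : Store) (a a' b b' : ℕ) :
    Exec compare
      (v, { s with inp := u ++ rest, r1 := w₁, r2 := w₂, d1 := ticks a, d1r := ticks a',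
                   d2 := ticks b, d2r := ticks b' }) (4 * u.length + 4)
      ({ v with x := none, y := none, z := none, far1 := v.far1 || decide (a < dist w₁ u),
                far2 := v.far2 || decide (b < dist w₂ u) },
        { s with inp := rest, vr := u.reverse ++ s.vr, r1 := [], r2 := [], p1 := w₁.reverse ++ s.p1,
                 p2 := w₂.reverse ++ s.p2, d1 := ticks (a - dist w₁ u),
                 d1r := ticks (a' + min a (dist w₁ u)), d2 := ticks (b - dist w₂ u),
                 d2r := ticks (b' + min b (dist w₂ u)) }) := by
  obtain ⟨r, x, y, z, md, fd, bd, nj, ex, gd, f₁, f₂, nz⟩ := v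
  obtain rfl : r = none := hv
  induction u generalizing w₁ w₂ x y z f₁ f₂ s a a' b b' with
  | nil =>
    obtain rfl := List.length_eq_zero_iff.1 h₁
    obtain rfl := List.length_eq_zero_iff.1 h₂
    refine .mono (.loop_done (.seq (.block rfl) (.seq (.block rfl) (.block ?_))) rfl) (by simp)
    simp [dist]
    rfl
  | cons c u ih =>
    obtain ⟨e, w₁, rfl⟩ : ∃ b q, w₁ = b :: q := List.exists_cons_of_length_eq_add_one h₁
    obtain ⟨e', w₂, rfl⟩ : ∃ b q, w₂ = b :: q := List.exists_cons_of_length_eq_add_one h₂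
    have h3 := ih w₁ w₂ (by simpa using h₁) (by simpa using h₂)
      { s with vr := c :: s.vr, p1 := e :: s.p1, p2 := e' :: s.p2 }
      (a - (mism e c).toNat) (a' + min a (mism e c).toNat) (b - (mism e' c).toNat)
      (b' + min b (mism e' c).toNat) (some e) (some e') (some c)
      (f₁ || decide (a < (mism e c).toNat)) (f₂ || decide (b < (mism e' c).toNat))
    have h4 : Exec compare (⟨none, x, y, z, md, fd, bd, nj, ex, gd, f₁, f₂, nz⟩,
        { s with inp := c :: u ++ rest, r1 := e :: w₁, r2 := e' :: w₂, d1 := ticks a,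
                 d1r := ticks a', d2 := ticks b, d2r := ticks b' }) _ _ :=
      .loop_more (.seq (.block rfl) (.seq (.block (eval_mismX
      ⟨none, some e, some e', some c, md, fd, bd, nj, ex, gd, f₁, f₂, nz⟩
      { s with inp := u ++ rest, r1 := w₁, r2 := w₂, vr := c :: s.vr, p1 := e :: s.p1,
               p2 := e' :: s.p2, d2 := ticks b, d2r := ticks b' } rfl a a'))
      (.block (eval_mismY _
      { s with inp := u ++ rest, r1 := w₁, r2 := w₂, vr := c :: s.vr, p1 := e :: s.p1,
               p2 := e' :: s.p2, d1 := ticks (a - (mism e c).toNat),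
               d1r := ticks (a' + min a (mism e c).toNat) } rfl b b')))) rfl h3
    refine .mono (h4.cast rfl ?_) ?_
    · simp only [dist, List.reverse_cons, List.append_assoc, List.singleton_append, Bool.or_assoc,
        Nat.sub_sub, Nat.add_assoc, lt_or_sub_lt, min_add_min_sub]
      rfl
    · simp only [List.length_cons]
      omega

/-! ### Processing the list of votes -/

/-- The code of a list of votes. -/
def votesCode (us : List (List Sym)) : List Sym := us.flatMap fun u => none :: u

/-- The memory between two blocks of code. -/
def vars (mode : Option Bool) (found bad nj excess good : Bool) : Vars :=
  ⟨none, none, none, none, mode, found, bad, nj, excess, good, false, false, false⟩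

/-- Process a vote, after its separator. -/
def processVote : Program :=
  .seq (.block (.load clearReg .done)) (.seq compare (.seq (move .d1r .d1) (.seq (move .d2r .d2)
    (.seq (.block (.branch far1 (tick .l .lr fun v => { v with excess := true })
      (.branch far2 (.load (fun v => { v with good := true }) .done) .done)))
    (.seq (.block (.load (fun v => { v with far1 := false, far2 := false }) .done))
    (.seq rewind (.block (.load (fun v => { v with reg := some none }) .done))))))))

theorem replicate_append_replicate_of_add (a b c : ℕ) (h : a + b = c) :
    (ticks a).reverse ++ ticks b = ticks c := by
  rw [List.reverse_replicate, List.replicate_append_replicate, h]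

/-- Each vote ends with a `rewind`, which joins `missing` to `nj` again; the flag already contains
that value on entry, so it does not change. The final `some none` in `reg` keeps `voteLoop` running.
-/
theorem exec_processVote (w₁ w₂ u rest : List Sym) (h₁ : w₁.length = u.length)
    (h₂ : w₂.length = u.length) (md : Option Bool) (fd bd nj ex gd : Bool) (s : Store) (d a a' : ℕ)
    (hp₁ : s.p1 = []) (hp₂ : s.p2 = []) :
    Exec processVote
      ({ vars md fd bd (nj || missing w₁.reverse w₂.reverse) ex gd with reg := some none },
        { s with inp := u ++ rest, r1 := w₁, r2 := w₂, d1 := ticks d, d1r := [], d2 := ticks d,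
                 d2r := [], l := ticks a, lr := ticks a' }) (6 * u.length + 4 * d + 20)
      ({ vars md fd bd (nj || missing w₁.reverse w₂.reverse)
          (ex || decide (a < (decide (d < dist w₁ u)).toNat))
          (gd || (!decide (d < dist w₁ u) && decide (d < dist w₂ u))) with reg := some none },
        { s with inp := rest, vr := u.reverse ++ s.vr, r1 := w₁, r2 := w₂, d1 := ticks d, d1r := [],
                 d2 := ticks d, d2r := [], l := ticks (a - (decide (d < dist w₁ u)).toNat),
                 lr := ticks (a' + min a (decide (d < dist w₁ u)).toNat) }) := by
  obtain ⟨si, sp₁, sr₁, sb₁, sp₂, sr₂, sb₂, svr, sl, slr, sd₁, sd₁r, sd₂, sd₂r, sn, st⟩ := s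
  obtain rfl : sp₁ = [] := hp₁
  obtain rfl : sp₂ = [] := hp₂
  set nj' := nj || missing w₁.reverse w₂.reverse with hnj
  have e1 := exec_compare w₁ w₂ u rest h₁ h₂ (vars md fd bd nj' ex gd) rfl
    ⟨si, [], sr₁, sb₁, [], sr₂, sb₂, svr, ticks a, ticks a', sd₁, sd₁r, sd₂, sd₂r, sn, st⟩ d 0 d 0
  set f₁ := decide (d < dist w₁ u) with hf₁
  set f₂ := decide (d < dist w₂ u) with hf₂
  simp only [Nat.zero_add, List.append_nil] at e1
  have e2 := exec_move (a := .d1r) (b := .d1) (by decide)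
    { vars md fd bd nj' ex gd with far1 := f₁, far2 := f₂ }
    ⟨rest, w₁.reverse, [], sb₁, w₂.reverse, [], sb₂, u.reverse ++ svr, ticks a, ticks a',
      ticks (d - dist w₁ u), ticks (min d (dist w₁ u)), ticks (d - dist w₂ u),
      ticks (min d (dist w₂ u)), sn, st⟩
  have e3 := exec_move (a := .d2r) (b := .d2) (by decide)
    { vars md fd bd nj' ex gd with far1 := f₁, far2 := f₂ }
    ⟨rest, w₁.reverse, [], sb₁, w₂.reverse, [], sb₂, u.reverse ++ svr, ticks a, ticks a',
      ticks d, [], ticks (d - dist w₂ u), ticks (min d (dist w₂ u)), sn, st⟩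
  have e4 := eval_far1 { vars md fd bd nj' ex gd with far1 := f₁, far2 := f₂ }
    ⟨rest, w₁.reverse, [], sb₁, w₂.reverse, [], sb₂, u.reverse ++ svr, ticks a, ticks a',
      ticks d, [], ticks d, [], sn, st⟩ rfl a a'
  have hnn : (nj' || missing w₁.reverse w₂.reverse) = nj' := by
    rw [hnj, Bool.or_assoc, Bool.or_self]
  have e5 := (exec_rewind w₁.reverse w₂.reverse (by simp [h₁, h₂])
    (vars md fd bd nj' (ex || decide (a < f₁.toNat)) (gd || (!f₁ && f₂)))
    ⟨rest, [], [], sb₁, [], [], sb₂, u.reverse ++ svr, ticks (a - f₁.toNat),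
      ticks (a' + min a f₁.toNat), ticks d, [], ticks d, [], sn, st⟩).cast rfl
    (t' := (vars md fd bd nj' (ex || decide (a < f₁.toNat)) (gd || (!f₁ && f₂)),
      ⟨rest, [], w₁, sb₁, [], w₂, sb₂, u.reverse ++ svr, ticks (a - f₁.toNat),
        ticks (a' + min a f₁.toNat), ticks d, [], ticks d, [], sn, st⟩)) (by simp [vars, hnn])
  have m1 := replicate_append_replicate_of_add (min d (dist w₁ u)) (d - dist w₁ u) d (by omega)
  have m2 := replicate_append_replicate_of_add (min d (dist w₂ u)) (d - dist w₂ u) d (by omega)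
  refine .mono (.seq (.block rfl) (.seq e1 (.seq (e2.cast rfl (congrArg (fun t => (_, (⟨rest,
    w₁.reverse, [], sb₁, w₂.reverse, [], sb₂, u.reverse ++ svr, ticks a, ticks a', t, [],
    ticks (d - dist w₂ u), ticks (min d (dist w₂ u)), sn, st⟩ : Store))) m1))
    (.seq (e3.cast rfl (congrArg (fun t => (_, (⟨rest,
    w₁.reverse, [], sb₁, w₂.reverse, [], sb₂, u.reverse ++ svr, ticks a, ticks a', ticks d, [],
    t, [], sn, st⟩ : Store))) m2)) (.seq (.block e4) (.seq (.block rfl) (.seq e5 (.block rfl)))))))) ?_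
  have l1 : ∀ i, (ticks i).length = i := fun i => List.length_replicate
  have l2 : w₁.reverse.length = u.length := by simp [h₁]
  change 1 + (4 * u.length + 4 + (2 * (ticks (min d (dist w₁ u))).length + 2 +
    (2 * (ticks (min d (dist w₂ u))).length + 2 + (1 + (1 + (2 * w₁.reverse.length + 2 + 1)))))) ≤ _
  rw [l1, l1, l2]
  omega

/-- Process all votes. -/
def voteLoop : Program :=
  .loop (.seq (.block (.pop .inp setReg (.branch regSome (.push .vr getReg .done) .done)))
    (.ite regSome processVote (.block .done))) regSome

/-- The number of votes at distance more than `d` from `w`. -/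
def farCount (d : ℕ) (w : List Sym) (us : List (List Sym)) : ℕ :=
  us.countP fun u => decide (d < dist w u)

/-- Some vote is at distance at most `d` from `w₁` and more than `d` from `w₂`. -/
def separated (d : ℕ) (w₁ w₂ : List Sym) (us : List (List Sym)) : Bool :=
  us.any fun u => !decide (d < dist w₁ u) && decide (d < dist w₂ u)

theorem exec_voteLoop {m : ℕ} (w₁ w₂ : List Sym) (us : List (List Sym)) (hus : ∀ u ∈ us, u.length = m)
    (h₁ : w₁.length = m) (h₂ : w₂.length = m) (md : Option Bool) (fd bd nj ex gd : Bool)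
    (s : Store) (d a a' : ℕ) (o : Option Sym)
    (hp₁ : s.p1 = []) (hp₂ : s.p2 = []) :
    Exec voteLoop
      ({ vars md fd bd (nj || missing w₁.reverse w₂.reverse) ex gd with reg := o },
        { s with inp := votesCode us, r1 := w₁, r2 := w₂, d1 := ticks d, d1r := [], d2 := ticks d,
                 d2r := [], l := ticks a, lr := ticks a' }) (us.length * (6 * m + 4 * d + 30) + 5)
      (vars md fd bd (nj || missing w₁.reverse w₂.reverse)
          (ex || decide (a < farCount d w₁ us)) (gd || separated d w₁ w₂ us),
        { s with inp := [], vr := (votesCode us).reverse ++ s.vr, r1 := w₁, r2 := w₂, d1 := ticks d,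
                 d1r := [], d2 := ticks d, d2r := [], l := ticks (a - farCount d w₁ us),
                 lr := ticks (a' + min a (farCount d w₁ us)) }) := by
  induction us generalizing ex gd s a a' o with
  | nil =>
    refine .mono (.loop_done (.seq (.block rfl) (.ite_false rfl (.block ?_))) rfl) (by simp)
    simp [farCount, separated, votesCode, Block.eval]
    rfl
  | cons u us ih =>
    obtain rfl : u.length = m := hus u List.mem_cons_self
    have e1 := exec_processVote w₁ w₂ u (votesCode us) h₁ h₂ md fd bd nj ex gd
      { s with vr := none :: s.vr } d a a' hp₁ hp₂
    have e2 := ih (fun u' hu' => hus u' (List.mem_cons_of_mem _ hu'))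
      (ex || decide (a < (decide (d < dist w₁ u)).toNat))
      (gd || (!decide (d < dist w₁ u) && decide (d < dist w₂ u)))
      { s with vr := u.reverse ++ none :: s.vr } (a - (decide (d < dist w₁ u)).toNat)
      (a' + min a (decide (d < dist w₁ u)).toNat) (some none) hp₁ hp₂
    have e3 : Exec voteLoop
        ({ vars md fd bd (nj || missing w₁.reverse w₂.reverse) ex gd with reg := o },
        { s with inp := votesCode (u :: us), r1 := w₁, r2 := w₂, d1 := ticks d, d1r := [],
                 d2 := ticks d, d2r := [], l := ticks a, lr := ticks a' }) _ _ :=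
      .loop_more (.seq (.block rfl) (.ite_true rfl e1)) rfl e2
    have hc : farCount d w₁ (u :: us) = (decide (d < dist w₁ u)).toNat + farCount d w₁ us := by
      rw [farCount, List.countP_cons, add_comm, farCount]
      cases decide (d < dist w₁ u) <;> rfl
    have hv : (votesCode (u :: us)).reverse = (votesCode us).reverse ++ (u.reverse ++ [none]) := by
      simp [votesCode]
    have hs : separated d w₁ w₂ (u :: us) =
        ((!decide (d < dist w₁ u) && decide (d < dist w₂ u)) || separated d w₁ w₂ us) := rfl
    refine .mono (e3.cast rfl ?_) ?_
    · simp only [hc, hv, hs, List.append_assoc, List.singleton_append, Bool.or_assoc,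
        Nat.sub_sub, Nat.add_assoc, lt_or_sub_lt, min_add_min_sub]
    · rw [List.length_cons, add_mul]
      omega

/-! ### Checking pairs of committees, and outer committees -/

/-- Check one pair of committees. -/
def checkPair : Program :=
  .seq rewind (.seq voteLoop (.seq (move .r1 .p1) (.seq (move .r2 .p2) (.seq (move .vr .inp)
    (.seq (move .lr .l) (.block (.pop .b2 setReg (.branch regSome
      (.push .b2 (fun _ => none)
        (.load (fun v => vars v.mode v.found v.bad false false false) .done))
      (.load (fun v => vars v.mode v.found (v.bad || (v.nj && (v.excess || !v.good)))
        false false false) .done)))))))))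

/-- The inner committee with reversed symbols `q₂` and `b` missing members refutes the outer
committee with reversed symbols `q₁`. -/
def refutes (d l : ℕ) (us : List (List Sym)) (q₁ q₂ : List Sym) (b : ℕ) : Bool :=
  b == 0 && (missing q₁ q₂ &&
    (decide (l < farCount d q₁.reverse us) || !separated d q₁.reverse q₂.reverse us))

theorem length_votesCode {m : ℕ} (us : List (List Sym)) (hus : ∀ u ∈ us, u.length = m) :
    (votesCode us).length = us.length * (m + 1) := by
  induction us with
  | nil => simp [votesCode]
  | cons u us ih =>
    have : votesCode (u :: us) = none :: (u ++ votesCode us) := rfl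
    rw [this, List.length_cons, List.length_append, ih fun u' hu' => hus u' (List.mem_cons_of_mem _ hu'),
      hus u List.mem_cons_self, List.length_cons]
    ring

/-- The store is the same before and after, as `exec_dfs` requires of a leaf: the committees return
from `r1` and `r2`, the votes from `vr`, the spent marks of `l` from `lr`. The hypotheses `hd` and
`hl` serve the time bound. -/
theorem exec_checkPair {m : ℕ} (q₁ q₂ : List Sym) (us : List (List Sym))
    (hus : ∀ u ∈ us, u.length = m) (h₁ : q₁.length = m) (h₂ : q₂.length = m) (md : Option Bool)
    (fd bd : Bool) (d l b : ℕ) (hd : d ≤ m) (hl : l ≤ us.length * (m + 1)) (b₁ : List Sym) :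
    Exec checkPair
      (vars md fd bd false false false,
        (⟨votesCode us, q₁, [], b₁, q₂, [], ticks b, [], ticks l, [], ticks d, [], ticks d, [],
          [], []⟩ : Store)) (50 * ((us.length + 1) * (m + 1)))
      (vars md fd (bd || refutes d l us q₁ q₂ b) false false false,
        (⟨votesCode us, q₁, [], b₁, q₂, [], ticks b, [], ticks l, [], ticks d, [], ticks d, [],
          [], []⟩ : Store)) := by
  -- This rewind computes `nj` before any vote is read, so the flag is right also for an empty list
  -- of votes.
  have e1 := (exec_rewind q₁ q₂ (h₁.trans h₂.symm) (vars md fd bd false false false)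
    ⟨votesCode us, q₁, [], b₁, q₂, [], ticks b, [], ticks l, [], ticks d, [], ticks d, [],
      [], []⟩).cast rfl (t' := (vars md fd bd (missing q₁ q₂) false false,
    ⟨votesCode us, [], q₁.reverse, b₁, [], q₂.reverse, ticks b, [], ticks l, [], ticks d, [],
      ticks d, [], [], []⟩)) (by simp [vars])
  set f := farCount d q₁.reverse us with hf
  have e2 := exec_voteLoop (m := m) q₁.reverse q₂.reverse us hus (by simpa) (by simpa) md fd bd
    false false false ⟨votesCode us, [], q₁.reverse, b₁, [], q₂.reverse, ticks b, [], ticks l, [],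
      ticks d, [], ticks d, [], [], []⟩ d l 0 none rfl rfl
  simp only [List.reverse_reverse, Bool.false_or, List.append_nil, Nat.zero_add, ← hf] at e2
  set v := vars md fd bd (missing q₁ q₂) (decide (l < f)) (separated d q₁.reverse q₂.reverse us)
    with hv
  have e3 := (exec_move (a := .r1) (b := .p1) (by decide) v
    ⟨[], [], q₁.reverse, b₁, [], q₂.reverse, ticks b, (votesCode us).reverse, ticks (l - f),
      ticks (min l f), ticks d, [], ticks d, [], [], []⟩).cast rfl (t' := (v,
    ⟨[], q₁, [], b₁, [], q₂.reverse, ticks b, (votesCode us).reverse, ticks (l - f),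
      ticks (min l f), ticks d, [], ticks d, [], [], []⟩)) (congrArg (fun t => (v, (⟨[], t, [], b₁,
      [], q₂.reverse, ticks b, (votesCode us).reverse, ticks (l - f), ticks (min l f), ticks d, [],
      ticks d, [], [], []⟩ : Store))) ((List.append_nil _).trans q₁.reverse_reverse))
  have e4 := (exec_move (a := .r2) (b := .p2) (by decide) v
    ⟨[], q₁, [], b₁, [], q₂.reverse, ticks b, (votesCode us).reverse, ticks (l - f),
      ticks (min l f), ticks d, [], ticks d, [], [], []⟩).cast rfl (t' := (v,
    ⟨[], q₁, [], b₁, q₂, [], ticks b, (votesCode us).reverse, ticks (l - f),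
      ticks (min l f), ticks d, [], ticks d, [], [], []⟩)) (congrArg (fun t => (v, (⟨[], q₁, [], b₁,
      t, [], ticks b, (votesCode us).reverse, ticks (l - f), ticks (min l f), ticks d, [],
      ticks d, [], [], []⟩ : Store))) ((List.append_nil _).trans q₂.reverse_reverse))
  have e5 := (exec_move (a := .vr) (b := .inp) (by decide) v
    ⟨[], q₁, [], b₁, q₂, [], ticks b, (votesCode us).reverse, ticks (l - f),
      ticks (min l f), ticks d, [], ticks d, [], [], []⟩).cast rfl (t' := (v,
    ⟨votesCode us, q₁, [], b₁, q₂, [], ticks b, [], ticks (l - f),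
      ticks (min l f), ticks d, [], ticks d, [], [], []⟩)) (congrArg (fun t => (v, (⟨t, q₁, [], b₁,
      q₂, [], ticks b, [], ticks (l - f), ticks (min l f), ticks d, [],
      ticks d, [], [], []⟩ : Store))) ((List.append_nil _).trans (votesCode us).reverse_reverse))
  have e6 := (exec_move (a := .lr) (b := .l) (by decide) v
    ⟨votesCode us, q₁, [], b₁, q₂, [], ticks b, [], ticks (l - f),
      ticks (min l f), ticks d, [], ticks d, [], [], []⟩).cast rfl (t' := (v,
    ⟨votesCode us, q₁, [], b₁, q₂, [], ticks b, [], ticks l, [], ticks d, [], ticks d, [], [],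
      []⟩)) (congrArg (fun t => (v, (⟨votesCode us, q₁, [], b₁, q₂, [], ticks b, [], t, [],
      ticks d, [], ticks d, [], [], []⟩ : Store)))
      (replicate_append_replicate_of_add (min l f) (l - f) l (by omega)))
  refine .mono (.seq e1 (.seq e2 (.seq e3 (.seq e4 (.seq e5 (.seq e6 (.block ?_))))))) ?_
  -- A mark left on `b2` means that the inner set has fewer than `k` members; such a leaf must not
  -- refute anything.
  · cases b with
    | zero =>
      have : refutes d l us q₁ q₂ 0 = (missing q₁ q₂ && (decide (l < f) ||
        !separated d q₁.reverse q₂.reverse us)) := by simp [refutes, hf]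
      rw [this]
      rfl
    | succ b =>
      have : refutes d l us q₁ q₂ (b + 1) = false := by simp [refutes]
      rw [this, Bool.or_false]
      rfl
  · change 2 * q₁.length + 2 + (us.length * (6 * m + 4 * d + 30) + 5 + (2 * q₁.reverse.length + 2 +
      (2 * q₂.reverse.length + 2 + (2 * (votesCode us).reverse.length + 2 +
      (2 * (ticks (min l f)).length + 2 + 1))))) ≤ _
    rw [List.length_reverse, List.length_reverse, List.length_reverse, length_votesCode us hus, h₁,
      h₂, List.length_replicate]
    have : us.length * (6 * m + 4 * d + 30) ≤ us.length * (30 * (m + 1)) :=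
      Nat.mul_le_mul_left _ (by omega)
    have : min l f ≤ us.length * (m + 1) := (min_le_left _ _).trans hl
    have : us.length * (30 * (m + 1)) = 30 * (us.length * (m + 1)) := by ring
    rw [add_mul (us.length)]
    omega

/-- Check one outer committee. -/
def checkCommittee : Program :=
  .seq (.block (.pop .b1 setReg (.branch regSome (.push .b1 (fun _ => none) .done) .done)))
    (.ite regSome (.block (.load clearReg .done))
      (.seq (dfs .p2 .r2 .b2 checkPair)
        (.block (.load (fun v => vars (some true) (v.found || !v.bad) false false false false)
          .done))))

/-- The outer committee with reversed symbols `q` and `b` missing members is not refuted. -/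
def admissible (m k l : ℕ) (us : List (List Sym)) (d : ℕ) (q : List Sym) (b : ℕ) : Bool :=
  b == 0 && !dfsAny (refutes d l us q) [] (List.replicate m (some false)) k

/-- The running time of the check of a pair of committees. -/
def pairTime (m n : ℕ) : ℕ := 50 * ((n + 1) * (m + 1))

/-- The running time of the check of an outer committee. -/
def committeeTime (m n k : ℕ) : ℕ :=
  dfsTime (pairTime m n) (List.replicate m (some false)) k + 20

/-- The inner search uses `mode` itself and leaves it at `none`, so the last block resets it to
`some true` for the outer search and clears `bad`. A mark left on `b1` means that the outer set is
too small, and the inner search is skipped. -/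
theorem exec_checkCommittee {m : ℕ} (q : List Sym) (us : List (List Sym))
    (hus : ∀ u ∈ us, u.length = m) (hq : q.length = m) (fd : Bool) (d l b k : ℕ) (hd : d ≤ m)
    (hl : l ≤ us.length * (m + 1)) :
    Exec checkCommittee
      (vars (some true) fd false false false false,
        (⟨votesCode us, q, [], ticks b, [], List.replicate m (some false), ticks k, [], ticks l, [],
          ticks d, [], ticks d, [], [], []⟩ : Store)) (committeeTime m us.length k)
      (vars (some true) (fd || admissible m k l us d q b) false false false false,
        (⟨votesCode us, q, [], ticks b, [], List.replicate m (some false), ticks k, [], ticks l, [],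
          ticks d, [], ticks d, [], [], []⟩ : Store)) := by
  cases b with
  | zero =>
    have h := exec_dfs (P := .p2) (R := .r2) (B := .b2) (leaf := checkPair)
      (fun p r b => ⟨votesCode us, q, [], [], p, r, ticks b, [], ticks l, [],
          ticks d, [], ticks d, [], [], []⟩) (fun _ _ _ => rfl) (fun _ _ _ => rfl) (fun _ _ _ => rfl)
      (fun _ _ _ _ => rfl) (fun _ _ _ _ => rfl) (fun _ _ _ _ => rfl)
      (fun a => vars none fd a false false false) (refutes d l us q) (pairTime m us.length) m
      (fun q₂ b a hq₂ => exec_checkPair q q₂ us hus hq hq₂ (some true) fd a d l b hd hl [])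
      (List.replicate m (some false)) (fun a ha => .inr (List.eq_of_mem_replicate ha))
      List.length_replicate k false (vars (some true) fd false false false false) rfl
    refine .mono (.seq (.block rfl) (.ite_false rfl (.seq h (.block ?_)))) ?_
    · simp only [admissible, beq_self_eq_true, Bool.true_and, Bool.false_or]
      rfl
    · unfold committeeTime
      omega
  | succ b =>
    have : admissible m k l us d q (b + 1) = false := by simp [admissible]
    rw [this, Bool.or_false]
    exact .mono (.seq (.block rfl) (.ite_true rfl (.block rfl))) (by unfold committeeTime; omega)

/-! ### The search over all distances -/

/-- Search for an outer committee, for each distance. -/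
def search : Program :=
  .loop (.seq (dfs .p1 .r1 .b1 checkCommittee) (.block (.pop .d1 setReg (.pop .d2 setReg .done))))
    regSome

/-- Some number up to `d` satisfies `f`. -/
def anyUpTo (f : ℕ → Bool) : ℕ → Bool
  | 0 => f 0
  | d + 1 => f (d + 1) || anyUpTo f d

theorem anyUpTo_iff (f : ℕ → Bool) (d : ℕ) : anyUpTo f d = true ↔ ∃ d' ≤ d, f d' = true := by
  induction d with
  | zero => simp [anyUpTo]
  | succ d ih =>
    rw [anyUpTo, Bool.or_eq_true, ih]
    constructor
    · rintro (h | ⟨d', hd', h⟩)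
      · exact ⟨_, le_rfl, h⟩
      · exact ⟨d', by omega, h⟩
    · rintro ⟨d', hd', h⟩
      rcases Nat.lt_or_eq_of_le hd' with hd' | rfl
      · exact .inr ⟨d', by omega, h⟩
      · exact .inl h

/-- The distance is held in unary on `d1` and `d2`, and each round removes one mark from both. The
pop comes after the search and fails only at distance `0`, so `0` is tested too and there are `d +
1` rounds. -/
theorem exec_search {m : ℕ} (us : List (List Sym)) (hus : ∀ u ∈ us, u.length = m) (r : List Sym)
    (hr : ∀ a ∈ r, a = none ∨ a = some false) (hrm : r.length = m) (fd : Bool) (d l b k : ℕ)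
    (hd : d ≤ m) (hl : l ≤ us.length * (m + 1)) (o : Option Sym) (mode : Option Bool) :
    Exec search
      ({ vars mode fd false false false false with reg := o },
        (⟨votesCode us, [], r, ticks b, [], List.replicate m (some false), ticks k, [], ticks l, [],
          ticks d, [], ticks d, [], [], []⟩ : Store))
      ((d + 1) * (dfsTime (committeeTime m us.length k) r b + 20))
      (vars none (fd || anyUpTo (fun d => dfsAny (admissible m k l us d) [] r b) d)
          false false false false,
        (⟨votesCode us, [], r, ticks b, [], List.replicate m (some false), ticks k, [], ticks l, [],
          [], [], [], [], [], []⟩ : Store)) := by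
  have h : ∀ fd d (_ : d ≤ m) o mode, Exec (dfs .p1 .r1 .b1 checkCommittee)
      ({ vars mode fd false false false false with reg := o },
        (⟨votesCode us, [], r, ticks b, [], List.replicate m (some false), ticks k, [], ticks l, [],
          ticks d, [], ticks d, [], [], []⟩ : Store))
      (dfsTime (committeeTime m us.length k) r b + 10)
      (vars none (fd || dfsAny (admissible m k l us d) [] r b) false false false false,
        (⟨votesCode us, [], r, ticks b, [], List.replicate m (some false), ticks k, [], ticks l, [],
          ticks d, [], ticks d, [], [], []⟩ : Store)) := fun fd d hd o mode =>
    exec_dfs (P := .p1) (R := .r1) (B := .b1) (leaf := checkCommittee)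
      (fun p r b => ⟨votesCode us, p, r, ticks b, [], List.replicate m (some false), ticks k, [],
          ticks l, [], ticks d, [], ticks d, [], [], []⟩) (fun _ _ _ => rfl) (fun _ _ _ => rfl)
      (fun _ _ _ => rfl) (fun _ _ _ _ => rfl) (fun _ _ _ _ => rfl) (fun _ _ _ _ => rfl)
      (fun a => vars none a false false false false) (admissible m k l us d)
      (committeeTime m us.length k) m
      (fun q b a hq => exec_checkCommittee q us hus hq a d l b k hd hl) r hr hrm b fd _ rfl
  induction d generalizing fd o mode with
  | zero => exact .mono (.loop_done (.seq (h fd 0 hd o mode) (.block rfl)) rfl) (by omega)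
  | succ d ih =>
    have h2 := ih (fd || dfsAny (admissible m k l us (d + 1)) [] r b) (by omega) (some none) none
    rw [Bool.or_assoc] at h2
    refine .mono (.loop_more (.seq (h fd (d + 1) hd o mode) (.block rfl)) rfl h2) ?_
    rw [add_mul (d + 1)]
    omega

/-! #### Reading the input -/

/-- The symbol read is a bit. -/
def isBit (v : Vars) : Bool := v.reg.join.isSome

/-- The entry of the template of the outer committee for a candidate. -/
def place (b : Bool) : Sym := if b then none else some false

/-- Read the distinguished candidates. -/
def readTemplate : Program :=
  .loop (.block (.pop .inp setReg (.branch isBit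
    (.push .p1 (fun v => place (v.reg.join == some true)) (.push .r2 (fun _ => some false)
      (.push .d1 (fun _ => none) (.push .d2 (fun _ => none) .done))))
    (.load clearReg .done)))) isBit

/-- Reading `J` also yields the number of candidates in unary: each bit adds an entry to the inner
template and a mark to both copies of the initial distance. -/
theorem exec_readTemplate (bs : List Bool) (rest : List Sym) (v : Vars) (s : Store) (n : ℕ) :
    Exec readTemplate
      (v, { s with inp := bs.map some ++ none :: rest, r2 := List.replicate n (some false),
                   d1 := ticks n, d2 := ticks n }) (2 * bs.length + 2)
      ({ v with reg := none },
        { s with inp := rest, p1 := (bs.map place).reverse ++ s.p1,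
                 r2 := List.replicate (n + bs.length) (some false), d1 := ticks (n + bs.length),
                 d2 := ticks (n + bs.length) }) := by
  induction bs generalizing v s n with
  | nil => exact .loop_done (.block rfl) rfl
  | cons b bs ih =>
    have h := ih { v with reg := some (some b) } { s with p1 := place b :: s.p1 } (n + 1)
    have h2 : Exec readTemplate (v,
        { s with inp := (b :: bs).map some ++ none :: rest,
                 r2 := List.replicate n (some false), d1 := ticks n, d2 := ticks n }) _ _ :=
      .loop_more (.block (by cases b <;> rfl)) rfl h
    refine .mono (h2.cast rfl ?_) ?_
    · simp [Nat.add_assoc, Nat.add_comm 1]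
    · rw [List.length_cons]
      omega

/-- Read a binary number, up to a separator or the end of the input. -/
def readNumber : Program :=
  .seq (.loop (.block (.pop .inp setReg (.branch isBit (.push .tmp getReg .done)
    (.branch regSome (.push .inp (fun _ => none) (.load clearReg .done)) .done)))) isBit)
    (move .tmp .num)

theorem exec_readNumber_aux (bs : List Bool) (rest : List Sym)
    (hrest : rest = [] ∨ ∃ t, rest = none :: t) (v : Vars) (s : Store) :
    Exec (.loop (.block (.pop .inp setReg (.branch isBit (.push .tmp getReg .done)
      (.branch regSome (.push .inp (fun _ => none) (.load clearReg .done)) .done)))) isBit)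
      (v, { s with inp := bs.map some ++ rest }) (2 * bs.length + 2)
      ({ v with reg := none }, { s with inp := rest, tmp := (bs.map some).reverse ++ s.tmp }) := by
  induction bs generalizing v s with
  | nil =>
    rcases hrest with rfl | ⟨t, rfl⟩
    · exact .loop_done (.block rfl) rfl
    · exact .loop_done (.block rfl) rfl
  | cons b bs ih =>
    have h := ih { v with reg := some (some b) } { s with tmp := some b :: s.tmp }
    have h2 : Exec _ (v, { s with inp := (b :: bs).map some ++ rest }) _ _ :=
      .loop_more (.block rfl) rfl h
    refine .mono (h2.cast rfl ?_) ?_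
    · simp
    · rw [List.length_cons]
      omega

/-- A separator that ends the number is pushed back. In `hrest` the input may also end here, as it
does after `l` when there are no votes. Passing through `tmp` puts the least significant digit back
on top. -/
theorem exec_readNumber (bs : List Bool) (rest : List Sym)
    (hrest : rest = [] ∨ ∃ t, rest = none :: t) (v : Vars) (s : Store) (hnum : s.num = [])
    (htmp : s.tmp = []) :
    Exec readNumber (v, { s with inp := bs.map some ++ rest }) (4 * bs.length + 4)
      ({ v with reg := none }, { s with inp := rest, num := bs.map some }) := by
  obtain ⟨si, sp₁, sr₁, sb₁, sp₂, sr₂, sb₂, svr, sl, slr, sd₁, sd₁r, sd₂, sd₂r, sn, st⟩ := s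
  obtain rfl : sn = [] := hnum
  obtain rfl : st = [] := htmp
  have h1 := exec_readNumber_aux bs rest hrest v
    ⟨si, sp₁, sr₁, sb₁, sp₂, sr₂, sb₂, svr, sl, slr, sd₁, sd₁r, sd₂, sd₂r, [], []⟩
  rw [List.append_nil] at h1
  have h2 := exec_move (a := .tmp) (b := .num) (by decide) { v with reg := none }
    ⟨rest, sp₁, sr₁, sb₁, sp₂, sr₂, sb₂, svr, sl, slr, sd₁, sd₁r, sd₂, sd₂r, [],
      (bs.map some).reverse⟩
  have h3 := h2.cast rfl (congrArg (fun t => ({ v with reg := none }, (⟨rest, sp₁, sr₁, sb₁, sp₂,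
    sr₂, sb₂, svr, sl, slr, sd₁, sd₁r, sd₂, sd₂r, t, []⟩ : Store)))
    ((List.append_nil _).trans (bs.map some).reverse_reverse))
  refine .mono (.seq h1 h3) ?_
  change _ + (2 * (bs.map some).reverse.length + 2) ≤ _
  rw [List.length_reverse, List.length_map]
  omega

/-! ### Binary counters and their conversion to unary -/

/-- The number with given binary digits, least significant digit first. -/
def value : List Bool → ℕ
  | [] => 0
  | b :: bs => b.toNat + 2 * value bs

theorem value_encodePosNum (n : PosNum) : value (Computability.encodePosNum n) = n := by
  induction n with
  | one => rfl
  | bit0 n ih =>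
    rw [Computability.encodePosNum, value, ih, PosNum.cast_bit0]
    simp [two_mul]
  | bit1 n ih =>
    rw [Computability.encodePosNum, value, ih, PosNum.cast_bit1]
    simp [two_mul, Nat.add_comm]

theorem value_encodeNat (n : ℕ) : value (Computability.encodeNat n) = n := by
  have : ∀ n : Num, value (Computability.encodeNum n) = n := by
    rintro (_ | n)
    · rfl
    · exact value_encodePosNum n
  rw [Computability.encodeNat, this, Num.to_of_nat]

/-- Decrement the binary number. -/
def decrement : Program :=
  .seq (.loop (.block (.pop .num setReg (.branch (fun v => v.reg == some (some false))
    (.push .tmp (fun _ => some true) .done) .done))) (fun v => v.reg == some (some false)))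
    (.ite regSome
      (.seq (.block (.push .num (fun _ => some false)
        (.load (fun v => { v with reg := none, nz := true }) .done))) (move .tmp .num))
      (.seq (.block (.load (fun v => { v with nz := false }) .done)) (clear .tmp)))

/-- This is the borrow: low-order zeros are popped and return as ones if a digit one follows. If all
digits are zero, `decrement` discards the ones on `tmp`. -/
theorem exec_skipZeros (i j : ℕ) (t : List Sym) (ht : t.head? ≠ some (some false)) (v : Vars)
    (s : Store) :
    Exec (.loop (.block (.pop .num setReg (.branch (fun v => v.reg == some (some false))
      (.push .tmp (fun _ => some true) .done) .done))) (fun v => v.reg == some (some false)))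
      (v, { s with num := List.replicate i (some false) ++ t, tmp := List.replicate j (some true) })
      (2 * i + 2)
      ({ v with reg := t.head? },
        { s with num := t.tail, tmp := List.replicate (i + j) (some true) }) := by
  induction i generalizing j v with
  | zero =>
    rw [show 0 + j = j from Nat.zero_add j]
    refine .loop_done (.block ?_) (beq_eq_false_iff_ne.2 ht)
    have : (t.head? == some (some false)) = false := beq_eq_false_iff_ne.2 ht
    change (bif t.head? == some (some false) then _ else _) = _
    rw [this]
    rfl
  | succ i ih =>
    refine .mono (.loop_more (.block rfl) rfl
      ((ih (j + 1) { v with reg := some (some false) }).cast rfl ?_)) (by omega)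
    rw [Nat.add_assoc i, Nat.add_comm j]

theorem eq_replicate_false_or (bs : List Bool) :
    (∃ i, bs = List.replicate i false) ∨ ∃ i t, bs = List.replicate i false ++ true :: t := by
  induction bs with
  | nil => exact .inl ⟨0, rfl⟩
  | cons b bs ih =>
    cases b
    · rcases ih with ⟨i, rfl⟩ | ⟨i, t, rfl⟩
      · exact .inl ⟨i + 1, rfl⟩
      · exact .inr ⟨i + 1, t, rfl⟩
    · exact .inr ⟨0, bs, rfl⟩

theorem value_replicate_false (i : ℕ) : value (List.replicate i false) = 0 := by
  induction i with
  | zero => rfl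
  | succ i ih => simp [List.replicate_succ, value, ih]

theorem value_replicate_true_append (i : ℕ) (t : List Bool) :
    value (List.replicate i true ++ false :: t) + 1 =
      value (List.replicate i false ++ true :: t) := by
  induction i with
  | zero => simp [value, Nat.add_comm]
  | succ i ih =>
    simp only [List.replicate_succ, List.cons_append, value, Bool.toNat_true, Bool.toNat_false]
    omega

theorem exec_decrement (bs : List Bool) (v : Vars) (s : Store) :
    ∃ bs' : List Bool, bs'.length ≤ bs.length ∧ value bs' = value bs - 1 ∧
      Exec decrement (v, { s with num := bs.map some, tmp := [] }) (4 * bs.length + 10)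
        ({ v with reg := none, nz := decide (0 < value bs) },
          { s with num := bs'.map some, tmp := [] }) := by
  rcases eq_replicate_false_or bs with ⟨i, rfl⟩ | ⟨i, t, rfl⟩
  · refine ⟨[], by simp, by simp [value_replicate_false, value], ?_⟩
    have h1 := exec_skipZeros i 0 [] (by simp) v s
    have h2 := exec_clear .tmp { v with reg := none, nz := false }
      { s with num := [], tmp := List.replicate i (some true) }
    rw [value_replicate_false, List.map_replicate]
    rw [List.append_nil] at h1
    refine .mono (.seq h1 (.ite_false rfl (.seq (.block rfl) h2))) ?_
    change _ + (1 + (2 * (List.replicate i (some true)).length + 2) + 1) ≤ _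
    simp only [List.length_replicate]
    omega
  · have hv := value_replicate_true_append i t
    refine ⟨List.replicate i true ++ false :: t, by simp, by omega, ?_⟩
    have h1 := exec_skipZeros i 0 (some true :: t.map some) (by simp) v s
    have h2 := exec_move (a := .tmp) (b := .num) (by decide) { v with reg := none, nz := true }
      { s with num := some false :: t.map some, tmp := List.replicate i (some true) }
    have h3 := h2.cast rfl (t' := ({ v with reg := none, nz := true }, { s with
      num := (List.replicate i true ++ false :: t).map some, tmp := [] })) (congrArg (fun t' =>
        ({ v with reg := none, nz := true }, { s with num := t', tmp := [] })) (by
          change (List.replicate i (some true)).reverse ++ some false :: t.map some = _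
          simp))
    have hpos : decide (0 < value (List.replicate i false ++ true :: t)) = true :=
      decide_eq_true (by omega)
    rw [hpos, List.map_append, List.map_replicate, List.map_cons]
    refine .mono (.seq h1 (.ite_true rfl (.seq (.block rfl) h3))) ?_
    change _ + (1 + (2 * (List.replicate i (some true)).length + 2) + 1) ≤ _
    simp only [List.length_replicate, List.length_append, List.length_cons]
    omega

/-- Convert the binary number to unary, up to the length of the stack `a`, which is moved to `b`.
The result is pushed to two stacks. -/
def toUnary (a b o₁ o₂ : Stk) : Program :=
  .loop (.seq (.block (.pop a setX (.branch xSome (.push b getX .done) .done)))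
    (.ite xSome
      (.seq decrement (.block (.branch nz
        (.push o₁ (fun _ => none) (.push o₂ (fun _ => none)
          (.load (fun v => { v with nz := false }) .done))) .done)))
      (.block .done))) xSome

/-- One decrement is made per symbol of `a`, so the time is polynomial even for a value exponential
in its number of digits, at the price of capping the result. Decrementing never lengthens the
number, so `N` bounds the cost of every round. -/
theorem exec_toUnary {a b o₁ o₂ : Stk} (st : List Sym → List Sym → List Sym → ℕ → Store)
    (hcons : ∀ x ra rb n c (v : Vars), (Block.pop a setX (.branch xSome (.push b getX .done) .done)).eval
      (v, st (x :: ra) rb n c) = ({ v with x := some x }, st ra (x :: rb) n c))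
    (hnil : ∀ rb n c (v : Vars), (Block.pop a setX (.branch xSome (.push b getX .done) .done)).eval
      (v, st [] rb n c) = ({ v with x := none }, st [] rb n c))
    (hpush : ∀ ra rb n c (v : Vars), (Block.push o₁ (fun _ => none) (.push o₂ (fun _ => none)
          (.load (fun v => { v with nz := false }) .done))).eval (v, st ra rb n c) =
        ({ v with nz := false }, st ra rb n (c + 1)))
    (hst : ∀ ra rb n c n', { st ra rb n c with num := n', tmp := [] } = st ra rb n' c)
    (N : ℕ) (ra rb : List Sym) (bs : List Bool) (hN : bs.length ≤ N) (c : ℕ) (v : Vars)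
    (hv : v.reg = none) (hv' : v.nz = false) :
    ∃ bs' : List Bool, bs'.length ≤ N ∧
      Exec (toUnary a b o₁ o₂) (v, st ra rb (bs.map some) c) (ra.length * (4 * N + 20) + 5)
        ({ v with x := none },
          st [] (ra.reverse ++ rb) (bs'.map some) (c + min ra.length (value bs))) := by
  obtain ⟨r, x, y, z, md, fd, bd, nj, ex, gd, f₁, f₂, nz⟩ := v
  obtain rfl : r = none := hv
  obtain rfl : nz = false := hv'
  induction ra generalizing rb bs c x with
  | nil =>
    refine ⟨bs, hN, ?_⟩
    rw [List.length_nil, Nat.zero_min, Nat.add_zero]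
    exact .mono (.loop_done (.seq (.block (hnil _ _ _ _)) (.ite_false rfl (.block rfl))) rfl)
      (by omega)
  | cons a₀ ra ih =>
    obtain ⟨bs₁, hl₁, hv₁, h₁⟩ := exec_decrement bs
      ⟨none, some a₀, y, z, md, fd, bd, nj, ex, gd, f₁, f₂, false⟩ (st ra (a₀ :: rb) (bs.map some) c)
    rw [hst, hst] at h₁
    obtain ⟨bs₂, hl₂, h₂⟩ := ih (a₀ :: rb) bs₁ (hl₁.trans hN)
      (c + (decide (0 < value bs)).toNat) (some a₀)
    refine ⟨bs₂, hl₂, ?_⟩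
    have h3 : (Block.branch nz (.push o₁ (fun _ => none) (.push o₂ (fun _ => none)
          (.load (fun v => { v with nz := false }) .done))) .done).eval
        (⟨none, some a₀, y, z, md, fd, bd, nj, ex, gd, f₁, f₂, decide (0 < value bs)⟩,
          st ra (a₀ :: rb) (bs₁.map some) c) =
        (⟨none, some a₀, y, z, md, fd, bd, nj, ex, gd, f₁, f₂, false⟩,
          st ra (a₀ :: rb) (bs₁.map some) (c + (decide (0 < value bs)).toNat)) := by
      rw [Block.eval]
      cases decide (0 < value bs)
      · rfl
      · exact hpush _ _ _ _ _
    have hc : c + (decide (0 < value bs)).toNat + min ra.length (value bs₁) =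
        c + min (a₀ :: ra).length (value bs) := by
      rw [List.length_cons, hv₁]
      by_cases h : 0 < value bs
      · rw [decide_eq_true h, Bool.toNat_true]
        omega
      · rw [decide_eq_false h, Bool.toNat_false]
        omega
    rw [List.reverse_cons, List.append_assoc, List.singleton_append, ← hc]
    refine .mono (.loop_more (.seq (.block (hcons _ _ _ _ _ _))
      (.ite_true rfl (.seq h₁ (.block h3)))) rfl h₂) ?_
    rw [List.length_cons, add_mul ra.length]
    omega

/-- Put the template in place, and subtract the number of distinguished candidates. -/
def placeTemplate : Program :=
  .loop (.block (.pop .p1 setReg (.branch regSome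
    (.push .r1 getReg (.branch (fun v => v.reg == some none) (.pop .b1 (fun v _ => v) .done) .done))
    .done))) regSome

theorem exec_placeTemplate (t : List Sym) (v : Vars) (s : Store) (b : ℕ) :
    Exec placeTemplate (v, { s with p1 := t, b1 := ticks b }) (2 * t.length + 2)
      ({ v with reg := none },
        { s with p1 := [], r1 := t.reverse ++ s.r1, b1 := ticks (b - t.count none) }) := by
  induction t generalizing v s b with
  | nil => exact .loop_done (.block rfl) rfl
  | cons a t ih =>
    have h := ih { v with reg := some a } { s with r1 := a :: s.r1 } (b - if a = none then 1 else 0)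
    have h2 : Exec placeTemplate (v, { s with p1 := a :: t, b1 := ticks b }) _ _ :=
      .loop_more (.block (by
        cases a with
        | none => cases b <;> rfl
        | some a => rfl)) rfl h
    refine .mono (h2.cast rfl ?_) ?_
    · have : b - (if a = none then 1 else 0) - t.count none = b - (a :: t).count none := by
        rw [List.count_cons]
        cases a <;> simp
        omega
      simp [this]
    · rw [List.length_cons]
      omega

/-! ### The complete program and its running time -/

/-- The whole program. -/
def decideControl : Program :=
  .seq readTemplate (.seq readNumber (.seq (toUnary .d1 .d1r .b1 .b2) (.seq (move .d1r .d1)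
    (.seq (clear .num) (.seq (.block (.pop .inp (fun v _ => v) .done)) (.seq readNumber
    (.seq (toUnary .inp .vr .l .lr) (.seq (move .vr .inp) (.seq (clear .num) (.seq (clear .lr)
    (.seq placeTemplate (.seq search (.seq (clear .inp) (.seq (clear .r1) (.seq (clear .b1)
    (.seq (clear .r2) (.seq (clear .b2) (clear .l))))))))))))))))))

/-- The store with a given input. -/
def inputStore (inp : List Sym) : Store :=
  ⟨inp, [], [], [], [], [], [], [], [], [], [], [], [], [], [], []⟩

/-- The answer of the program. -/
def answer (J : List Bool) (k l : ℕ) (us : List (List Sym)) : Bool :=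
  anyUpTo (fun d => dfsAny (admissible J.length k (min (us.length * (J.length + 1)) l) us d) []
    (J.map place) (k - J.count true)) J.length

/-- The running time of the search. -/
def searchTime (J : List Bool) (k n : ℕ) : ℕ :=
  (J.length + 1) * (dfsTime (committeeTime J.length n k) (J.map place) (k - J.count true) + 20)

/-- Apart from the search time `S`, only the two conversions to unary are quadratic, each a product
of two lengths; everything else is linear in `N`. -/
theorem totalTime_le {m k k' l V x y x' y' S N : ℕ} (hN : m + x + y + V + 2 = N) (hk : k ≤ m)
    (hx : x' ≤ x) (hy : y' ≤ y) (hl : l ≤ V) (hk' : k' ≤ k) :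
    2 * m + 2 + (4 * x + 4 + (m * (4 * x + 20) + 5 + (2 * m + 2 + (2 * x' + 2 + (1 + (4 * y + 4 +
    (V * (4 * y + 20) + 5 + (2 * V + 2 + (2 * y' + 2 + (2 * l + 2 + (2 * m + 2 + (S + (2 * V + 2 +
    (2 * m + 2 + (2 * k' + 2 + (2 * m + 2 + (2 * k + 2 + (2 * l + 2)))))))))))))))))) ≤
      100 * N ^ 2 + S := by
  have h₁ : m * (4 * x + 20) ≤ N * (24 * N) := Nat.mul_le_mul (by omega) (by omega)
  have h₂ : V * (4 * y + 20) ≤ N * (24 * N) := Nat.mul_le_mul (by omega) (by omega)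
  -- The two separators counted in `N` give `2 ≤ N`.
  have h₃ : 2 * N ≤ N * N := Nat.mul_le_mul_right _ (by omega)
  have h₄ : N * (24 * N) = 24 * (N * N) := by ring
  rw [sq]
  linarith

theorem exec_decideControl (J K L : List Bool) (us : List (List Sym))
    (hus : ∀ u ∈ us, u.length = J.length) (hk : value K ≤ J.length) (N : ℕ)
    (hN : J.length + K.length + L.length + us.length * (J.length + 1) + 2 = N) :
    Exec decideControl (vars none false false false false false,
        inputStore (J.map some ++ none :: (K.map some ++ none :: (L.map some ++ votesCode us))))
      (100 * N ^ 2 + searchTime J (value K) us.length)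
      (vars none (answer J (value K) (value L) us) false false false false, inputStore []) := by
  set m := J.length with hm
  set V := us.length * (m + 1) with hV
  have hVl : (votesCode us).length = V := length_votesCode us hus
  set v := vars none false false false false false with hv
  have e1 := exec_readTemplate J (K.map some ++ none :: (L.map some ++ votesCode us)) v
    (inputStore []) 0
  simp only [inputStore, List.append_nil, Nat.zero_add, ← hm] at e1
  have e2 := exec_readNumber K (none :: (L.map some ++ votesCode us)) (.inr ⟨_, rfl⟩) v
    ⟨[], (J.map place).reverse, [], [], [], List.replicate m (some false), [], [], [], [], ticks m,
      [], ticks m, [], [], []⟩ rfl rfl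
  obtain ⟨K', hK', e3⟩ := exec_toUnary (a := .d1) (b := .d1r) (o₁ := .b1) (o₂ := .b2)
    (fun ra rb n c => ⟨none :: (L.map some ++ votesCode us), (J.map place).reverse, [], ticks c, [],
      List.replicate m (some false), ticks c, [], [], [], ra, rb, ticks m, [], n, []⟩)
    (fun _ _ _ _ _ _ => rfl) (fun _ _ _ _ => rfl) (fun _ _ _ _ _ => rfl) (fun _ _ _ _ _ => rfl)
    K.length (ticks m) [] K le_rfl 0 v rfl rfl
  simp only [List.length_replicate, List.reverse_replicate, List.append_nil, Nat.zero_add,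
    min_eq_right hk] at e3
  set k := value K with hkK
  have e4 := exec_move (a := .d1r) (b := .d1) (by decide) v
    ⟨none :: (L.map some ++ votesCode us), (J.map place).reverse, [], ticks k, [],
      List.replicate m (some false), ticks k, [], [], [], [], ticks m, ticks m, [], K'.map some, []⟩
  have e4' := e4.cast rfl (congrArg (fun t => (v, (⟨none :: (L.map some ++ votesCode us),
    (J.map place).reverse, [], ticks k, [], List.replicate m (some false), ticks k, [], [], [], t,
    [], ticks m, [], K'.map some, []⟩ : Store))) (replicate_append_replicate_of_add m 0 m rfl))
  have e5 := exec_clear .num v ⟨none :: (L.map some ++ votesCode us), (J.map place).reverse, [],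
    ticks k, [], List.replicate m (some false), ticks k, [], [], [], ticks m, [], ticks m, [],
    K'.map some, []⟩
  have e7 := exec_readNumber L (votesCode us) (by
      cases us with
      | nil => exact .inl rfl
      | cons u us => exact .inr ⟨_, rfl⟩) v
    ⟨[], (J.map place).reverse, [], ticks k, [], List.replicate m (some false), ticks k, [], [], [],
      ticks m, [], ticks m, [], [], []⟩ rfl rfl
  obtain ⟨L', hL', e8⟩ := exec_toUnary (a := .inp) (b := .vr) (o₁ := .l) (o₂ := .lr)
    (fun ra rb n c => ⟨ra, (J.map place).reverse, [], ticks k, [],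
      List.replicate m (some false), ticks k, rb, ticks c, ticks c, ticks m, [], ticks m, [], n, []⟩)
    (fun _ _ _ _ _ _ => rfl) (fun _ _ _ _ => rfl) (fun _ _ _ _ _ => rfl) (fun _ _ _ _ _ => rfl)
    L.length (votesCode us) [] L le_rfl 0 v rfl rfl
  simp only [List.append_nil, Nat.zero_add, hVl] at e8
  set l := min V (value L) with hl
  have e9 := (exec_move (a := .vr) (b := .inp) (by decide) v
    ⟨[], (J.map place).reverse, [], ticks k, [], List.replicate m (some false), ticks k,
      (votesCode us).reverse, ticks l, ticks l, ticks m, [], ticks m, [], L'.map some, []⟩).cast rfl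
    (congrArg (fun t => (v, (⟨t, (J.map place).reverse, [], ticks k, [],
      List.replicate m (some false), ticks k, [], ticks l, ticks l, ticks m, [], ticks m, [],
      L'.map some, []⟩ : Store))) ((List.append_nil _).trans (votesCode us).reverse_reverse))
  have e10 := exec_clear .num v ⟨votesCode us, (J.map place).reverse, [], ticks k, [],
    List.replicate m (some false), ticks k, [], ticks l, ticks l, ticks m, [], ticks m, [],
      L'.map some, []⟩
  have e11 := exec_clear .lr v ⟨votesCode us, (J.map place).reverse, [], ticks k, [],
    List.replicate m (some false), ticks k, [], ticks l, ticks l, ticks m, [], ticks m, [], [], []⟩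
  have hcount : (J.map place).reverse.count none = J.count true := by
    rw [List.count_reverse]
    clear_value m k l v V
    clear * -
    induction J with
    | nil => rfl
    | cons b J ih => cases b <;> simp [place, ih]
  have e12 := exec_placeTemplate (J.map place).reverse v ⟨votesCode us, (J.map place).reverse, [],
    ticks k, [], List.replicate m (some false), ticks k, [], ticks l, [], ticks m, [], ticks m, [],
      [], []⟩ k
  simp only [List.reverse_reverse, List.append_nil, hcount] at e12
  have e13 := exec_search us hus (J.map place) (by
      intro a ha
      obtain ⟨b, -, rfl⟩ := List.mem_map.1 ha
      cases b
      · exact .inr rfl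
      · exact .inl rfl) (List.length_map _) false m l (k - J.count true) k le_rfl
    (min_le_left _ _) none none
  simp only [Bool.false_or] at e13
  have ha : anyUpTo (fun d => dfsAny (admissible J.length k l us d) [] (J.map place)
      (k - J.count true)) m = answer J k (value L) us := rfl
  rw [ha] at e13
  set w := vars none (answer J k (value L) us) false false false false with hw
  -- From here on the remaining stacks are emptied, as `machine_outputsInTime` demands.
  have e14 := exec_clear .inp w ⟨votesCode us, [], J.map place, ticks (k - J.count true), [],
    List.replicate m (some false), ticks k, [], ticks l, [], [], [], [], [], [], []⟩
  have e15 := exec_clear .r1 w ⟨[], [], J.map place, ticks (k - J.count true), [],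
    List.replicate m (some false), ticks k, [], ticks l, [], [], [], [], [], [], []⟩
  have e16 := exec_clear .b1 w ⟨[], [], [], ticks (k - J.count true), [],
    List.replicate m (some false), ticks k, [], ticks l, [], [], [], [], [], [], []⟩
  have e17 := exec_clear .r2 w ⟨[], [], [], [], [],
    List.replicate m (some false), ticks k, [], ticks l, [], [], [], [], [], [], []⟩
  have e18 := exec_clear .b2 w ⟨[], [], [], [], [],
    [], ticks k, [], ticks l, [], [], [], [], [], [], []⟩
  have e19 := exec_clear .l w ⟨[], [], [], [], [],
    [], [], [], ticks l, [], [], [], [], [], [], []⟩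
  refine .mono (.seq e1 (.seq e2 (.seq e3 (.seq e4' (.seq e5 (.seq (.block rfl) (.seq e7 (.seq e8
    (.seq e9 (.seq e10 (.seq e11 (.seq e12 (.seq e13 (.seq e14 (.seq e15 (.seq e16 (.seq e17
    (.seq e18 e19)))))))))))))))))) ?_
  change 2 * J.length + 2 + (4 * K.length + 4 + (m * (4 * K.length + 20) + 5 +
    (2 * (ticks m).length + 2 + (2 * (K'.map some).length + 2 + (1 + (4 * L.length + 4 +
    (V * (4 * L.length + 20) + 5 + (2 * (votesCode us).reverse.length + 2 +
    (2 * (L'.map some).length + 2 + (2 * (ticks l).length + 2 +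
    (2 * (J.map place).reverse.length + 2 + ((m + 1) * (dfsTime (committeeTime m us.length k)
      (J.map place) (k - J.count true) + 20) + (2 * (votesCode us).length + 2 +
    (2 * (J.map place).length + 2 + (2 * (ticks (k - J.count true)).length + 2 +
    (2 * (List.replicate m (some false)).length + 2 + (2 * (ticks k).length + 2 +
    (2 * (ticks l).length + 2)))))))))))))))))) ≤ _
  simp only [List.length_replicate, List.length_reverse, List.length_map, hVl]
  exact totalTime_le hN hk hK' hL' (min_le_left _ _) (Nat.sub_le _ _)

end ControlMachine

namespace ApprovalVoting

/-! ### The combinatorial characterization -/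

theorem mavScore_le_iff {C : Type} [DecidableEq C] (V : Multiset (Finset C)) (w : Finset C)
    (d : ℕ) : mavScore V w ≤ d ↔ ∀ v ∈ V, hamming w v ≤ d := by
  simp [mavScore, Multiset.sup_le]

theorem hamming_le_card {m : ℕ} (w v : Finset (Fin m)) : hamming w v ≤ m := by
  have h := Finset.card_union_of_disjoint (disjoint_sdiff_sdiff (x := w) (y := v))
  rw [hamming, ← h]
  simpa using Finset.card_le_univ (w \ v ∪ v \ w)

/-- The bound on deletions stands under the quantifier over `w'` because it matters only if some
`k`-committee misses part of `J`; otherwise nothing has to be deleted. In this form both conditions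
are tested for each pair of committees. -/
theorem ccdv_mav_iff (I : CCDVInstance) :
    CCDV MAV I ↔ ∃ w : Finset (Fin I.m), I.J ⊆ w ∧ w.card = I.k ∧ ∃ d ≤ I.m,
      ∀ w' : Finset (Fin I.m), w'.card = I.k → ¬ I.J ⊆ w' →
        (I.votes.countP fun v => decide (d < hamming w v)) ≤ I.l ∧
          ∃ v ∈ I.votes, hamming w v ≤ d ∧ d < hamming w' v := by
  constructor
  · rintro ⟨D, hD, hDl, h⟩
    set R := (I.votes : Multiset (Finset (Fin I.m))) - D with hR
    obtain ⟨w, hw, hmin⟩ := Finset.exists_min_image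
      (Finset.univ.filter fun w : Finset (Fin I.m) => w.card = I.k) (mavScore R) (by
        obtain ⟨w, -, hw⟩ := Finset.exists_subset_card_eq
          (s := (Finset.univ : Finset (Fin I.m))) (n := I.k) (by simpa using I.k_le)
        exact ⟨w, by simpa using hw⟩)
    simp only [Finset.mem_filter, Finset.mem_univ, true_and] at hw hmin
    have hwin : w ∈ MAV I.m R I.k := ⟨hw, hmin⟩
    have hfar : ∀ v ∈ R, hamming w v ≤ mavScore R w := (mavScore_le_iff R w _).1 le_rfl
    refine ⟨w, h w hwin, hw, mavScore R w,
      (mavScore_le_iff R w _).2 fun v _ => hamming_le_card w v, fun w' hw' hJ => ⟨?_, ?_⟩⟩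
    · refine le_trans ?_ hDl
      have hsplit : (I.votes : Multiset (Finset (Fin I.m))) = R + D := (tsub_add_cancel_of_le hD).symm
      have hc : (I.votes.countP fun v => decide (mavScore R w < hamming w v)) =
          Multiset.countP (fun v => mavScore R w < hamming w v)
            (I.votes : Multiset (Finset (Fin I.m))) := rfl
      rw [hc, hsplit, Multiset.countP_add, Multiset.countP_eq_zero.2 fun v hv => not_lt.2 (hfar v hv),
        zero_add]
      exact Multiset.countP_le_card _ _
    -- If `w'` scored no more than the winner `w`, it would be a winner itself and contain `J`.
    · have hlt : ¬ mavScore R w' ≤ mavScore R w := fun hle =>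
        hJ (h w' ⟨hw', fun w'' hw'' => hle.trans (hmin w'' hw'')⟩)
      rw [mavScore_le_iff] at hlt
      push Not at hlt
      obtain ⟨v, hv, hvd⟩ := hlt
      exact ⟨v, Multiset.mem_coe.1 (Multiset.mem_of_le (Multiset.sub_le_self _ _) hv), hfar v hv, hvd⟩
  · rintro ⟨w, hJw, hw, d, -, h⟩
    by_cases hall : ∀ w' : Finset (Fin I.m), w'.card = I.k → I.J ⊆ w'
    · exact ⟨0, Multiset.zero_le _, by simp, fun w' hw' => hall w' hw'.1⟩
    push Not at hall
    -- Any committee missing part of `J` gives access to the bound on the number of deleted votes.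
    obtain ⟨w₀, hw₀, hJ₀⟩ := hall
    have hc := (h w₀ hw₀ hJ₀).1
    refine ⟨Multiset.filter (fun v => d < hamming w v) I.votes, Multiset.filter_le _ _, ?_, ?_⟩
    · rw [← Multiset.countP_eq_card_filter]
      exact hc
    · have hR : (I.votes : Multiset (Finset (Fin I.m))) -
          Multiset.filter (fun v => d < hamming w v) I.votes =
          Multiset.filter (fun v => ¬ d < hamming w v) I.votes :=
        tsub_eq_of_eq_add_rev (Multiset.filter_add_not _ _).symm
      rw [hR]
      rintro w' ⟨hw', hmin⟩
      by_contra hJ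
      -- The vote `v` survives the deletion and gives `w'` a score above `d`, while `w` scores at
      -- most `d`; so `w'` cannot win.
      obtain ⟨v, hv, hv₁, hv₂⟩ := (h w' hw' hJ).2
      have h₁ := (mavScore_le_iff (Multiset.filter (fun v => ¬ d < hamming w v) I.votes) w d).2
        fun v hv => not_lt.1 (Multiset.mem_filter.1 hv).2
      have h₂ := (mavScore_le_iff _ w' d).1 ((hmin w hw).trans h₁) v
        (Multiset.mem_filter.2 ⟨Multiset.mem_coe.2 hv, not_lt.2 hv₁⟩)
      omega

end ApprovalVoting

/-! ### The Boolean search in terms of committees -/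

namespace ControlMachine

open ApprovalVoting

/-- A completion keeps each `none` and may replace every other symbol by either bit, which is what
equality of `isSome` expresses. The accumulator `p` holds the decided symbols last first, hence the
reversal. -/
theorem dfsAny_iff (test : List Sym → ℕ → Bool) (r p : List Sym) (b : ℕ) :
    dfsAny test p r b = true ↔ ∃ q : List Sym, List.Forall₂ (fun a c => a.isSome = c.isSome) r q ∧
      q.count (some true) ≤ b ∧ test (q.reverse ++ p) (b - q.count (some true)) = true := by
  induction r generalizing p b with
  | nil => simp [dfsAny]
  | cons a r ih =>
    cases a with
    | none =>
      rw [dfsAny, ih]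
      constructor
      · rintro ⟨q, hq, hb, ht⟩
        exact ⟨none :: q, .cons rfl hq, by simpa using hb, by simpa using ht⟩
      · rintro ⟨q', hq', hb, ht⟩
        obtain ⟨c, q, hc, hq, rfl⟩ := List.forall₂_cons_left_iff.1 hq'
        obtain rfl : c = none := by simpa using hc.symm
        exact ⟨q, hq, by simpa using hb, by simpa using ht⟩
    | some a =>
      rw [show dfsAny test p (some a :: r) b = (dfsAny test (some false :: p) r b ||
        match b with
        | 0 => false
        | b + 1 => dfsAny test (some true :: p) r b) by cases b <;> rfl, Bool.or_eq_true, ih]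
      constructor
      · rintro (⟨q, hq, hb, ht⟩ | h)
        · exact ⟨some false :: q, .cons rfl hq, by simpa using hb, by simpa using ht⟩
        · cases b with
          | zero => simp at h
          | succ b =>
            obtain ⟨q, hq, hb, ht⟩ := (ih _ _).1 h
            exact ⟨some true :: q, .cons rfl hq, by simpa using hb, by simpa using ht⟩
      · rintro ⟨q', hq', hb, ht⟩
        obtain ⟨c, q, hc, hq, rfl⟩ := List.forall₂_cons_left_iff.1 hq'
        obtain ⟨c, rfl⟩ : ∃ c', c = some c' := Option.isSome_iff_exists.1 hc.symm
        cases c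
        · exact .inl ⟨q, hq, by simpa using hb, by simpa using ht⟩
        · rw [List.count_cons_self] at hb ht
          obtain ⟨b, rfl⟩ : ∃ b', b = b' + 1 := ⟨b - 1, by omega⟩
          exact .inr ((ih _ _).2 ⟨q, hq, by simpa using hb, by simpa using ht⟩)

/-- The symbol of a candidate for the committee `w`; the candidates in `J` are distinguished. -/
def symbol {m : ℕ} (J w : Finset (Fin m)) (i : Fin m) : Sym :=
  if i ∈ J then none else some (decide (i ∈ w))

/-- The list of symbols of a committee. -/
def symbols {m : ℕ} (J w : Finset (Fin m)) : List Sym := List.ofFn (symbol J w)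

theorem count_ofFn {α : Type} [BEq α] [LawfulBEq α] [DecidableEq α] {m : ℕ} (f : Fin m → α)
    (a : α) : (List.ofFn f).count a = (Finset.univ.filter fun i => f i = a).card := by
  rw [Finset.card_filter]
  induction m with
  | zero => simp
  | succ m ih =>
    rw [List.ofFn_succ, List.count_cons, ih, Fin.sum_univ_succ, add_comm]
    simp only [beq_iff_eq]

theorem count_symbols {m : ℕ} (J w : Finset (Fin m)) :
    (symbols J w).count (some true) = (w \ J).card := by
  rw [symbols, count_ofFn]
  congr 1
  ext i
  by_cases hi : i ∈ J <;> simp [symbol, hi]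

theorem dfsAny_ofFn_iff {m : ℕ} (J : Finset (Fin m)) (ρ : Fin m → Sym)
    (hρ : ∀ i, (ρ i).isSome = decide (i ∉ J)) (test : List Sym → ℕ → Bool) (b : ℕ) :
    dfsAny test [] (List.ofFn ρ) b = true ↔ ∃ w : Finset (Fin m), J ⊆ w ∧ (w \ J).card ≤ b ∧
      test (symbols J w).reverse (b - (w \ J).card) = true := by
  rw [dfsAny_iff]
  constructor
  · rintro ⟨q, hq, hb, ht⟩
    have hlen : q.length = m := by simpa using hq.length_eq.symm
    subst hlen
    -- A position belongs to the set unless its symbol is `some false`; the fixed symbols `none`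
    -- thus count as members, which gives `J ⊆ w`.
    have hq' : q = symbols J (Finset.univ.filter fun i => q.get i ≠ some false) := by
      rw [symbols]
      conv_lhs => rw [← List.ofFn_get q]
      congr 1
      funext i
      have h := List.Forall₂.get hq (i := i) (by simp) i.2
      simp only [List.get_eq_getElem, List.getElem_ofFn, Fin.eta, hρ] at h
      simp only [symbol, Finset.mem_filter, Finset.mem_univ, true_and, List.get_eq_getElem]
      by_cases hi : i ∈ J
      · simp only [hi, not_true_eq_false, decide_false] at h
        simpa [hi] using h.symm
      · simp only [hi, not_false_eq_true, decide_true] at h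
        obtain ⟨c, hc⟩ := Option.isSome_iff_exists.1 h.symm
        rw [hc]
        cases c <;> simp [hi]
    refine ⟨Finset.univ.filter fun i => q.get i ≠ some false, ?_, ?_, ?_⟩
    · intro i hi
      have h := List.Forall₂.get hq (i := i) (by simp) i.2
      simp only [List.get_eq_getElem, List.getElem_ofFn, Fin.eta, hρ, hi, not_true_eq_false,
        decide_false] at h
      simp only [Finset.mem_filter, Finset.mem_univ, true_and, List.get_eq_getElem]
      intro h'
      simp [h'] at h
    · rw [← count_symbols, ← hq']
      exact hb
    · rw [← count_symbols, ← hq']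
      simpa using ht
  · rintro ⟨w, hJ, hb, ht⟩
    refine ⟨symbols J w, ?_, ?_, ?_⟩
    · rw [symbols, List.forall₂_iff_get]
      refine ⟨by simp, fun i h₁ h₂ => ?_⟩
      simp only [List.get_eq_getElem, List.getElem_ofFn, hρ, symbol]
      split_ifs with h <;> simp [h]
    · rwa [count_symbols]
    · rwa [count_symbols, List.append_nil]

theorem dist_ofFn {m : ℕ} (f g : Fin m → Sym) :
    dist (List.ofFn f) (List.ofFn g) = ∑ i, (mism (f i) (g i)).toNat := by
  induction m with
  | zero => simp [dist]
  | succ m ih => rw [List.ofFn_succ, List.ofFn_succ, dist, ih, Fin.sum_univ_succ]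

/-- `mism` reads `none` as membership, which is right because `J ⊆ w`. The two halves of the Hamming
distance then merge into one sum over candidates. -/
theorem dist_symbols {m : ℕ} {J w : Finset (Fin m)} (hJ : J ⊆ w) (v : Finset (Fin m)) :
    dist (symbols J w) (CCDVInstance.bits v) = hamming w v := by
  have h₁ : w \ v = Finset.univ.filter fun i => i ∈ w ∧ i ∉ v := by ext; simp
  have h₂ : v \ w = Finset.univ.filter fun i => i ∈ v ∧ i ∉ w := by ext; simp
  rw [symbols, CCDVInstance.bits, dist_ofFn, hamming, h₁, h₂, Finset.card_filter,
    Finset.card_filter, ← Finset.sum_add_distrib]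
  refine Finset.sum_congr rfl fun i _ => ?_
  have := @hJ i
  by_cases hi : i ∈ J <;> by_cases hw : i ∈ w <;> by_cases hv : i ∈ v <;>
    simp_all [symbol, mism]
  rfl

theorem missing_iff (as bs : List Sym) :
    missing as bs = true ↔ ∃ i : ℕ, as[i]? = some none ∧ bs[i]? = some (some false) := by
  induction as generalizing bs with
  | nil => simp [missing]
  | cons a as ih =>
    cases bs with
    | nil => simp [missing]
    | cons b bs =>
      rw [missing, Bool.or_eq_true, ih]
      constructor
      · rintro (h | ⟨i, hi⟩)
        · exact ⟨0, by simpa using h⟩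
        · exact ⟨i + 1, by simpa using hi⟩
      · rintro ⟨_ | i, hi⟩
        · exact .inl (by simpa using hi)
        · exact .inr ⟨i, by simpa using hi⟩

/-- In both reversed lists candidate `i` sits at position `m - 1 - i`. Only the outer list carries
marks `none`; the inner one is written without distinguished candidates. -/
theorem missing_reverse_symbols {m : ℕ} (J w w' : Finset (Fin m)) :
    missing (symbols J w).reverse (symbols ∅ w').reverse = true ↔ ¬ J ⊆ w' := by
  rw [missing_iff]
  constructor
  · rintro ⟨i, h₁, h₂⟩ hJ
    obtain ⟨hi, h₁⟩ := List.getElem?_eq_some_iff.1 h₁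
    obtain ⟨hi', h₂⟩ := List.getElem?_eq_some_iff.1 h₂
    simp only [symbols, List.getElem_reverse, List.getElem_ofFn, symbol, List.length_ofFn] at h₁ h₂
    split_ifs at h₁ with h
    simp [hJ h] at h₂
  · intro h
    obtain ⟨i, hi, hi'⟩ := Finset.not_subset.1 h
    refine ⟨m - 1 - i, ?_, ?_⟩
    · rw [List.getElem?_reverse (by simp [symbols]; omega)]
      have : m - 1 - (m - 1 - i.1) = i.1 := by omega
      simp [symbols, this, symbol, hi]
    · rw [List.getElem?_reverse (by simp [symbols]; omega)]
      have : m - 1 - (m - 1 - i.1) = i.1 := by omega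
      simp [symbols, this, symbol, hi']

end ControlMachine

/-! ### Equivalence of the computed answer with the characterization -/

namespace ControlMachine

open StackMachine StackStore Vars ApprovalVoting TimeBounds

theorem farCount_map_bits {m : ℕ} {J w : Finset (Fin m)} (hJ : J ⊆ w) (vs : List (Finset (Fin m)))
    (d : ℕ) : farCount d (symbols J w) (vs.map CCDVInstance.bits) =
      vs.countP fun v => decide (d < hamming w v) := by
  rw [farCount, List.countP_map]
  congr 1
  funext v
  simp [dist_symbols hJ]

theorem separated_map_bits {m : ℕ} {J w : Finset (Fin m)} (hJ : J ⊆ w) (w' : Finset (Fin m))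
    (vs : List (Finset (Fin m))) (d : ℕ) :
    separated d (symbols J w) (symbols ∅ w') (vs.map CCDVInstance.bits) = true ↔
      ∃ v ∈ vs, hamming w v ≤ d ∧ d < hamming w' v := by
  simp [separated, dist_symbols hJ, dist_symbols (Finset.empty_subset w')]

/-- Capping `l` at the length of the code of the votes is harmless: that length is at least the
number of votes, so no count exceeds it. -/
theorem refutes_iff {m : ℕ} {J w : Finset (Fin m)} (hJ : J ⊆ w) (w' : Finset (Fin m))
    (vs : List (Finset (Fin m))) (d l b : ℕ) :
    refutes d (min (vs.length * (m + 1)) l) (vs.map CCDVInstance.bits) (symbols J w).reverse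
      (symbols ∅ w').reverse b = true ↔ b = 0 ∧ ¬ J ⊆ w' ∧
        ¬ ((vs.countP fun v => decide (d < hamming w v)) ≤ l ∧
          ∃ v ∈ vs, hamming w v ≤ d ∧ d < hamming w' v) := by
  rw [refutes, Bool.and_eq_true, Bool.and_eq_true, missing_reverse_symbols, Bool.or_eq_true,
    List.reverse_reverse, List.reverse_reverse, farCount_map_bits hJ, decide_eq_true_iff,
    beq_iff_eq, Bool.not_eq_true', ← Bool.not_eq_true, separated_map_bits hJ, not_and_or, not_le]
  have h₁ : (vs.countP fun v => decide (d < hamming w v)) ≤ vs.length := List.countP_le_length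
  have h₂ : vs.length ≤ vs.length * (m + 1) := Nat.le_mul_of_pos_right _ (Nat.succ_pos m)
  rw [min_lt_iff, or_iff_right (a := vs.length * (m + 1) < _) (by omega)]

/-- The inner search has no distinguished candidates and budget `k`; demanding that no mark remains
selects the sets with exactly `k` members. -/
theorem admissible_iff {m : ℕ} {J w : Finset (Fin m)} (hJ : J ⊆ w) (vs : List (Finset (Fin m)))
    (k d l b : ℕ) :
    admissible m k (min (vs.length * (m + 1)) l) (vs.map CCDVInstance.bits) d (symbols J w).reverse
      b = true ↔ b = 0 ∧ ∀ w' : Finset (Fin m), w'.card = k → ¬ J ⊆ w' →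
        (vs.countP fun v => decide (d < hamming w v)) ≤ l ∧
          ∃ v ∈ vs, hamming w v ≤ d ∧ d < hamming w' v := by
  have hF : List.replicate m (some false : Sym) = List.ofFn fun _ : Fin m => some false :=
    (List.ofFn_const m _).symm
  rw [admissible, Bool.and_eq_true, beq_iff_eq, Bool.not_eq_true', ← Bool.not_eq_true, hF,
    dfsAny_ofFn_iff ∅ _ (by simp)]
  refine and_congr_right fun _ => ⟨fun h w' hw' hJ' => ?_, ?_⟩
  · by_contra hn
    refine h ⟨w', Finset.empty_subset _, by simp [hw'], (refutes_iff hJ w' vs d l _).2 ⟨?_, hJ', hn⟩⟩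
    simp [hw']
  · rintro h ⟨w', -, hw', ht⟩
    obtain ⟨h₀, hJ', hn⟩ := (refutes_iff hJ w' vs d l _).1 ht
    rw [Finset.sdiff_empty] at hw' h₀
    exact hn (h w' (by omega) hJ')

/-- The characteristic bits of the distinguished candidates. -/
def templateBits (I : CCDVInstance) : List Bool := List.ofFn fun i => decide (i ∈ I.J)

/-- Spending the whole budget `k - |J|` outside `J` means `|w| = k`, because `J ⊆ w` and `|J| ≤ k`.
-/
theorem answer_iff (I : CCDVInstance) :
    answer (templateBits I) I.k I.l (I.votes.map CCDVInstance.bits) = true ↔ CCDV MAV I := by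
  have hlen : (templateBits I).length = I.m := List.length_ofFn
  have hcount : (templateBits I).count true = I.J.card := by
    rw [templateBits, count_ofFn]
    simp
  have hplace : (templateBits I).map place = List.ofFn fun i => place (decide (i ∈ I.J)) := by
    rw [templateBits, List.map_ofFn]
    rfl
  rw [answer, anyUpTo_iff, ccdv_mav_iff, hlen, hcount, hplace, List.length_map]
  have hρ : ∀ i, (place (decide (i ∈ I.J))).isSome = decide (i ∉ I.J) := fun i => by
    by_cases hi : i ∈ I.J <;> simp [place, hi]
  have hJk := I.J_card
  constructor
  · rintro ⟨d, hd, h⟩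
    obtain ⟨w, hJ, hw, ht⟩ := (dfsAny_ofFn_iff I.J _ hρ _ _).1 h
    obtain ⟨h₀, ht⟩ := (admissible_iff hJ _ _ _ _ _).1 ht
    have := Finset.card_sdiff_add_card_eq_card hJ
    exact ⟨w, hJ, by omega, d, hd, ht⟩
  · rintro ⟨w, hJ, hw, d, hd, ht⟩
    have := Finset.card_sdiff_add_card_eq_card hJ
    exact ⟨d, hd, (dfsAny_ofFn_iff I.J _ hρ _ _).2 ⟨w, hJ, by omega,
      (admissible_iff hJ _ _ _ _ _).2 ⟨by omega, ht⟩⟩⟩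

theorem encode_eq (I : CCDVInstance) :
    I.encode = (templateBits I).map some ++ none ::
      ((Computability.encodeNat I.k).map some ++ none ::
        ((Computability.encodeNat I.l).map some ++ votesCode (I.votes.map CCDVInstance.bits))) := by
  rw [CCDVInstance.encode, votesCode, List.flatMap_map, templateBits, List.map_ofFn]
  rfl

theorem size_eq (I : CCDVInstance) :
    I.size = I.m + (Computability.encodeNat I.k).length + (Computability.encodeNat I.l).length +
      I.votes.length * (I.m + 1) + 2 := by
  rw [CCDVInstance.size, encode_eq]
  simp only [List.length_append, List.length_cons, List.length_map]
  rw [length_votesCode (m := I.m) _ (by simp [CCDVInstance.bits]), templateBits, List.length_ofFn,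
    List.length_map]
  omega

/-! ### Time bounds -/

theorem searchTime_le {J : List Bool} {k n N : ℕ} (hJ : 0 < J.length)
    (hN : J.length + n * (J.length + 1) + 2 ≤ N) :
    searchTime J k n ≤ 380 * N ^ 4 * (J.length ^ k * J.length ^ (k - J.count true)) := by
  set m := J.length with hm
  set A := m ^ k
  set B := m ^ (k - J.count true) with hB
  have hA : 1 ≤ A := Nat.one_le_pow _ _ hJ
  have hB' : 1 ≤ B := Nat.one_le_pow _ _ hJ
  have hN1 : 1 ≤ N := by omega
  have h2m : 2 * m + 1 ≤ 2 * N := by omega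
  have hp : pairTime m n ≤ 50 * N := Nat.mul_le_mul_left _ (by rw [add_mul]; omega)
  have hNN : 1 ≤ N ^ 2 * A := Nat.mul_pos (by positivity) hA
  -- From `50 * N + 20 ≤ 70 * N` and `2 * m + 1 ≤ 2 * N` comes `140`, and the final `20` of
  -- `committeeTime` makes it `160`. The same computation for the outer search gives `180`, `360`
  -- and `380`.
  have hc : committeeTime m n k ≤ 160 * (N ^ 2 * A) := by
    have h := dfsTime_le (T := pairTime m n) hJ (List.replicate m (some false)) k
      (by rw [List.length_replicate])
    rw [List.length_replicate] at h
    have h' : (pairTime m n + 20) * (2 * m + 1) * m ^ k ≤ (70 * N) * (2 * N) * A :=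
      Nat.mul_le_mul_right _ (Nat.mul_le_mul (by omega) h2m)
    have h'' : (70 * N) * (2 * N) * A = 140 * (N ^ 2 * A) := by ring
    unfold committeeTime
    omega
  have hd : dfsTime (committeeTime m n k) (J.map place) (k - J.count true) ≤
      360 * (N ^ 3 * A * B) := by
    have h := dfsTime_le (T := committeeTime m n k) hJ (J.map place) (k - J.count true)
      (by rw [List.length_map])
    rw [List.length_map] at h
    have h' : (committeeTime m n k + 20) * (2 * m + 1) * m ^ (k - J.count true) ≤
        (180 * (N ^ 2 * A)) * (2 * N) * B :=
      Nat.mul_le_mul_right _ (Nat.mul_le_mul (by omega) h2m)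
    have h'' : (180 * (N ^ 2 * A)) * (2 * N) * B = 360 * (N ^ 3 * A * B) := by ring
    exact h.trans (h'.trans h''.le)
  have hNN' : 1 ≤ N ^ 3 * A * B := Nat.mul_pos (Nat.mul_pos (by positivity) hA) hB'
  have hs : searchTime J k n = (m + 1) * (dfsTime (committeeTime m n k) (J.map place)
    (k - J.count true) + 20) := rfl
  calc searchTime J k n ≤ N * (380 * (N ^ 3 * A * B)) := hs.trans_le <|
        Nat.mul_le_mul (by omega) (by omega)
    _ = _ := by ring

/-- The machine that decides control by deleting voters. -/
noncomputable def controlMachine : Turing.TM2ComputableAux Sym Bool where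
  tm := machine decideControl .inp (vars none false false false false false) found
  inputAlphabet := Equiv.refl Sym
  outputAlphabet := Equiv.refl Bool

theorem _root_.TimeBounds.DecidesInTime.mono {α Γ : Type} {M : Turing.TM2ComputableAux Γ Bool}
    {enc : α → List Γ} {P : α → Prop} {T T' : α → ℕ} (h : DecidesInTime M enc P T)
    (hT : ∀ a, T a ≤ T' a) : DecidesInTime M enc P T' := fun a =>
  (h a).map fun e => ⟨e.toEvalsTo, e.steps_le_m.trans (hT a)⟩

theorem controlMachine_decidesInTime :
    DecidesInTime controlMachine CCDVInstance.encode (CCDV MAV)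
      fun I => 500 * (I.m ^ I.k * I.m ^ (I.k - I.J.card)) * I.size ^ 4 := by
  intro I
  have hlen : (templateBits I).length = I.m := List.length_ofFn
  have hcount : (templateBits I).count true = I.J.card := by
    rw [templateBits, count_ofFn]
    simp
  have hm : 0 < I.m := I.k_pos.trans_le I.k_le
  have hsize := size_eq I
  have h := exec_decideControl (templateBits I) (Computability.encodeNat I.k)
    (Computability.encodeNat I.l) (I.votes.map CCDVInstance.bits)
    (by simp [CCDVInstance.bits, hlen]) (by rw [value_encodeNat, hlen]; exact I.k_le) I.size
    (by rw [hlen, List.length_map, hsize])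
  rw [value_encodeNat, value_encodeNat, ← encode_eq, List.length_map] at h
  have hs := searchTime_le (J := templateBits I) (k := I.k) (n := I.votes.length) (N := I.size)
    (by rwa [hlen]) (by rw [hlen, hsize]; omega)
  rw [hlen, hcount] at hs
  have hAB : 1 ≤ I.m ^ I.k * I.m ^ (I.k - I.J.card) := Nat.mul_pos (by positivity) (by positivity)
  set AB := I.m ^ I.k * I.m ^ (I.k - I.J.card)
  have hN1 : 1 ≤ I.size := by omega
  have hN2 : I.size ^ 2 ≤ I.size ^ 4 * AB :=
    (Nat.pow_le_pow_right hN1 (by norm_num)).trans (Nat.le_mul_of_pos_right _ hAB)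
  have hN3 : 1 ≤ I.size ^ 2 := Nat.one_le_pow _ _ hN1
  -- The three summands are at most `100`, `380` and `1` times `I.size ^ 4 * AB`; the `1` is the
  -- halting step.
  have htime : 100 * I.size ^ 2 + searchTime (templateBits I) I.k I.votes.length + 1 ≤
      500 * AB * I.size ^ 4 := by
    have e₁ : 500 * AB * I.size ^ 4 = 500 * (I.size ^ 4 * AB) := by ring
    have e₂ : 380 * I.size ^ 4 * AB = 380 * (I.size ^ 4 * AB) := by ring
    omega
  obtain ⟨out⟩ := machine_outputsInTime (k₀ := Stk.inp) (out := found) h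
    (fun k hk => by cases k <;> first | rfl | exact absurd rfl hk) (fun k => by cases k <;> rfl)
  have hans : answer (templateBits I) I.k I.l (I.votes.map CCDVInstance.bits) =
      @decide (CCDV MAV I) (Classical.propDecidable _) := by
    exact Bool.eq_iff_iff.2
      ((answer_iff I).trans (@decide_eq_true_iff _ (Classical.propDecidable _)).symm)
  have hin : (I.encode).map controlMachine.inputAlphabet.symm = I.encode := List.map_id _
  have e : Nonempty (Turing.TM2OutputsInTime controlMachine.tm I.encode (some [answer
      (templateBits I) I.k I.l (I.votes.map CCDVInstance.bits)]) (500 * AB * I.size ^ 4)) :=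
    ⟨⟨out.toEvalsTo, out.steps_le_m.trans htime⟩⟩
  rw [hans] at e
  rw [hin]
  exact e

/-- This serves the computability of the parameter function `m ↦ 500 * (m ^ m * m ^ m)`. -/
theorem primrec_pow : Primrec₂ fun a b : ℕ => a ^ b := by
  refine (Primrec.nat_rec (f := fun _ : ℕ => 1) (g := fun a p => p.2 * a) (Primrec.const 1)
    (Primrec.nat_mul.comp (Primrec.snd.comp Primrec.snd) Primrec.fst)).of_eq fun a b => ?_
  induction b with
  | zero => rfl
  | succ b ih => rw [pow_succ, ← ih]

end ControlMachine

/-! ### The three statements -/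

open ApprovalVoting TimeBounds in
theorem mainTheorem7 :
    -- for every constant committee size `k`, the problem is solvable in polynomial time
    (∀ k : ℕ, PolyTimeDecidable (fun I : {I : CCDVInstance // I.k = k} => I.1.encode)
      (fun I => CCDV MAV I.1)) ∧
    -- one algorithm, for all committee sizes, with its running time
    (∃ M : Turing.TM2ComputableAux (Option Bool) Bool,
      (∀ k : ℕ, ∃ c : ℕ,
        DecidesInTime M (fun I : {I : CCDVInstance // I.k = k} => I.1.encode)
          (fun I => CCDV MAV I.1) (fun I => c * I.1.m ^ k * I.1.size ^ c)) ∧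
      (∃ c : ℕ, DecidesInTime M CCDVInstance.encode (CCDV MAV)
        (fun I => c * (I.m ^ I.k * I.m ^ (I.k - I.J.card)) * I.size ^ c))) ∧
    -- fixed-parameter tractability in the number of candidates
    FixedParameterTractable CCDVInstance.encode (CCDV MAV) (fun I => I.m) := by
  have hmsize : ∀ I : CCDVInstance, I.m ≤ I.size := fun I => by
    rw [ControlMachine.size_eq]
    omega
  have hm : ∀ I : CCDVInstance, 0 < I.m := fun I => I.k_pos.trans_le I.k_le
  have hsize : ∀ I : CCDVInstance, 0 < I.size := fun I => (hm I).trans_le (hmsize I)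
  have hB : ∀ I : CCDVInstance, I.m ^ (I.k - I.J.card) ≤ I.size ^ I.k := fun I =>
    (Nat.pow_le_pow_right (hm I) (Nat.sub_le _ _)).trans (Nat.pow_le_pow_left (hmsize I) _)
  have hA : ∀ I : CCDVInstance, I.m ^ I.k ≤ I.size ^ I.k := fun I =>
    Nat.pow_le_pow_left (hmsize I) _
  -- The constant `c` serves as factor and as exponent; only `500 ≤ c` is used.
  obtain ⟨c, hc⟩ : ∃ c, 500 ≤ c := ⟨500, le_rfl⟩
  refine ⟨fun k => ?_, ⟨ControlMachine.controlMachine, fun k => ⟨k + c, ?_⟩, c, ?_⟩,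
    ControlMachine.controlMachine, fun m => 500 * (m ^ m * m ^ m), 4, ?_, ?_⟩
  · have h : DecidesInTime ControlMachine.controlMachine
        (fun I : {I : CCDVInstance // I.k = k} => I.1.encode) (fun I => CCDV MAV I.1)
        (fun I => (Polynomial.C 500 * Polynomial.X ^ (k + k + 4) : Polynomial ℕ).eval
          I.1.encode.length) :=
      DecidesInTime.mono (fun I => ControlMachine.controlMachine_decidesInTime I.1) fun I => by
        obtain ⟨I, rfl⟩ := I
        simp only [Polynomial.eval_mul, Polynomial.eval_C, Polynomial.eval_pow, Polynomial.eval_X]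
        change _ ≤ 500 * I.size ^ (I.k + I.k + 4)
        calc 500 * (I.m ^ I.k * I.m ^ (I.k - I.J.card)) * I.size ^ 4
            ≤ 500 * (I.size ^ I.k * I.size ^ I.k) * I.size ^ 4 :=
              Nat.mul_le_mul_right _ (Nat.mul_le_mul_left _ (Nat.mul_le_mul (hA I) (hB I)))
          _ = 500 * I.size ^ (I.k + I.k + 4) := by ring
    exact ⟨⟨_, _, fun I => (h I).some⟩⟩
  -- For fixed `k` the factor `m ^ (k - |J|)` is at most `I.size ^ k` and joins the polynomial part,
  -- so that only `m ^ k` remains in front.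
  · refine DecidesInTime.mono (fun I => ControlMachine.controlMachine_decidesInTime I.1) ?_
    rintro ⟨I, rfl⟩
    calc 500 * (I.m ^ I.k * I.m ^ (I.k - I.J.card)) * I.size ^ 4
        ≤ 500 * (I.m ^ I.k * I.size ^ I.k) * I.size ^ 4 :=
          Nat.mul_le_mul_right _ (Nat.mul_le_mul_left _ (Nat.mul_le_mul_left _ (hB I)))
      _ = 500 * I.m ^ I.k * I.size ^ (I.k + 4) := by ring
      _ ≤ (I.k + c) * I.m ^ I.k * I.size ^ (I.k + c) :=
          Nat.mul_le_mul (Nat.mul_le_mul_right _ (by omega))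
            (Nat.pow_le_pow_right (hsize I) (by omega))
  · exact ControlMachine.controlMachine_decidesInTime.mono fun I =>
      Nat.mul_le_mul (Nat.mul_le_mul_right _ hc) (Nat.pow_le_pow_right (hsize I) (by omega))
  · have hpow := ControlMachine.primrec_pow.comp Primrec.id Primrec.id
    exact (Primrec.nat_mul.comp (Primrec.const 500) (Primrec.nat_mul.comp hpow hpow)).to_comp
  -- Since `k ≤ m`, both exponents are at most `m`.
  · refine ControlMachine.controlMachine_decidesInTime.mono fun I => ?_
    exact Nat.mul_le_mul_right _ (Nat.mul_le_mul_left _ (Nat.mul_le_mul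
      (Nat.pow_le_pow_right (hm I) I.k_le)
      (Nat.pow_le_pow_right (hm I) ((Nat.sub_le _ _).trans I.k_le))))
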